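/- Let $\lambda\in(0,\infty)$, and let $\psi\ge 0$ be a function on $(0,1)$ that is a probability density on $(0,1)$ and satisfies $\lim_{x\uparrow 1}\psi(x)=\psi_1\in(0,\infty)$ (this is the case $\beta=0$ of the mixing density $\psi(x)(1-x)^\beta$, $x\in(0,1)$). Let $\alpha$ be a random variable with density $\psi$ on $(0,1)$ and let $X_0$, $\xi_{k,j}$, $\varepsilon_k$ ($k,j\in\mathbb N=\{1,2,\dots\}$) be random variables on the same probability space which are conditionally independent given $\alpha$ and satisfy, almost surely, $\mathbb P(\xi_{k,j}=1\mid\alpha)=\alpha=1-\mathbb P(\xi_{k,j}=0\mid\alpha)$, $\mathbb P(\varepsilon_k=\ell\mid\alpha)=\frac{\lambda^\ell}{\ell!}e^{-\lambda}$ and $\mathbb P(X_0=\ell\mid\alpha)=\frac{\lambda^\ell}{\ell!(1-\alpha)^\ell}e^{-\lambda/(1-\alpha)}$ for $\ell=0,1,2,\dots$. Let $$X_k=\sum_{j=1}^{X_{k-1}}\xi_{k,j}+\varepsilon_k,\qquad k\in\mathbb N$$ (a randomized stationary INAR(1) process with Poisson innovations). Let $\bigl(\alpha^{(j)},(X^{(j)}_k)_{k\ge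 0}\bigr)$, $j\in\mathbb N$, be independent copies of $\bigl(\alpha,(X_k)_{k\ge 0}\bigr)$, and for $N,n\in\mathbb N$ put $$S^{(N,n)}_t=\sum_{j=1}^{N}\sum_{k=1}^{\lfloor nt\rfloor}\Bigl(X^{(j)}_k-\frac{\lambda}{1-\alpha^{(j)}}\Bigr),\qquad t\in[0,\infty),$$ where $\frac{\lambda}{1-\alpha^{(j)}}=\mathbb E(X^{(j)}_k\mid\alpha^{(j)})$. Let $(N_n)_{n\in\mathbb N}$ be a sequence of positive integers with $(\log N_n)^2 n^{-1}\to\infty$ as $n\to\infty$. Then, as $n\to\infty$, the finite-dimensional distributions of the processes $$n^{-1}(N_n\log N_n)^{-1/2}\,S^{(N_n,n)}$$ converge weakly to those of $(Wt)_{t\in[0,\infty)}$, where $W$ is a normally distributed random variable (not depending on $t$) with mean $0$ and variance $\lambda\psi_1$. -/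

import Mathlib

open MeasureTheory ProbabilityTheory Filter Topology Set
open scoped NNReal ENNReal Nat

noncomputable section

/-- Conditional independence, given the sub-`σ`-algebra `m`, of a family of `ℕ`-valued random
variables: conditional probabilities of finite intersections factorize almost surely. -/
def CondIndepFamily {Ω ι : Type*} (m : MeasurableSpace Ω) [m₀ : MeasurableSpace Ω]
    (Z : ι → Ω → ℕ) (P : Measure[m₀] Ω) : Prop :=
  ∀ (s : Finset ι) (A : ι → Set ℕ),
    P⟦⋂ i ∈ s, Z i ⁻¹' A i | m⟧ =ᵐ[P] fun ω => ∏ i ∈ s, (P⟦Z i ⁻¹' A i | m⟧) ω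

/-- Labels of the random inputs of an INAR(1) process: the initial value, the Bernoulli thinning
variables and the innovations. -/
inductive INARInput : Type
  | init : INARInput
  | thin (k j : ℕ) : INARInput
  | innov (k : ℕ) : INARInput

/-- The initial value, the thinning variables and the innovations as one family. -/
def inarInputs {Ω : Type*} (X₀ : Ω → ℕ) (ξ : ℕ → ℕ → Ω → ℕ) (ε : ℕ → Ω → ℕ) :
    INARInput → Ω → ℕ
  | .init => X₀
  | .thin k j => ξ k j
  | .innov k => ε k

/-- The process `X 0 = X₀`, `X (k + 1) = ∑_{j < X k} ξ k j + ε k`. The variables `ξ k j` and `ε k`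
with `k, j = 0, 1, …` are those usually written `ξ_{k+1,j+1}` and `ε_{k+1}`. -/
def inarProcess {Ω : Type*} (X₀ : Ω → ℕ) (ξ : ℕ → ℕ → Ω → ℕ) (ε : ℕ → Ω → ℕ) : ℕ → Ω → ℕ
  | 0, ω => X₀ ω
  | k + 1, ω => (∑ j ∈ Finset.range (inarProcess X₀ ξ ε k ω), ξ k j ω) + ε k ω

/-- The inputs of a randomized INAR(1) process with random thinning parameter `α`, Poisson
innovations of parameter `lam` and stationary initial value: conditionally on `α`, all inputs are
independent, the thinning variables are Bernoulli with mean `α`, the innovations are Poisson with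
parameter `lam`, and the initial value is Poisson with parameter `lam / (1 - α)`. -/
structure IsRandomizedINAR {Ω : Type*} [MeasurableSpace Ω] (lam : ℝ) (α : Ω → ℝ)
    (X₀ : Ω → ℕ) (ξ : ℕ → ℕ → Ω → ℕ) (ε : ℕ → Ω → ℕ) (P : Measure Ω) : Prop where
  measurable_param : Measurable α
  param_mem : ∀ᵐ ω ∂P, α ω ∈ Ioo (0 : ℝ) 1
  measurable_init : Measurable X₀
  measurable_thin : ∀ k j, Measurable (ξ k j)
  measurable_innov : ∀ k, Measurable (ε k)
  condIndep : CondIndepFamily (MeasurableSpace.comap α inferInstance) (inarInputs X₀ ξ ε) P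
  thin_one : ∀ k j,
    P⟦ξ k j ⁻¹' {1} | MeasurableSpace.comap α inferInstance⟧ =ᵐ[P] fun ω => α ω
  thin_zero : ∀ k j,
    P⟦ξ k j ⁻¹' {0} | MeasurableSpace.comap α inferInstance⟧ =ᵐ[P] fun ω => 1 - α ω
  innov_law : ∀ k l : ℕ,
    P⟦ε k ⁻¹' {l} | MeasurableSpace.comap α inferInstance⟧ =ᵐ[P]
      fun _ => lam ^ l / (l ! : ℝ) * Real.exp (-lam)
  init_law : ∀ l : ℕ,
    P⟦X₀ ⁻¹' {l} | MeasurableSpace.comap α inferInstance⟧ =ᵐ[P]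
      fun ω => lam ^ l / ((l ! : ℝ) * (1 - α ω) ^ l) * Real.exp (-((1 - α ω)⁻¹ * lam))

/-- The measure `μ` on `ℝ` has the probability density `ψ x * (1 - x) ^ β` on `(0, 1)`, where
`ψ x → ψ₁ ∈ (0, ∞)` as `x ↑ 1`. The values of `ψ` outside `(0, 1)` play no role. -/
structure IsMixingLaw (μ : Measure ℝ) (ψ : ℝ → ℝ) (β ψ₁ : ℝ) : Prop where
  aemeasurable : AEMeasurable ψ (volume.restrict (Ioo (0 : ℝ) 1))
  nonneg : ∀ x ∈ Ioo (0 : ℝ) 1, 0 ≤ ψ x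
  law_eq : μ = (volume.restrict (Ioo (0 : ℝ) 1)).withDensity
    (fun x => ENNReal.ofReal (ψ x * (1 - x) ^ β))
  limit_pos : 0 < ψ₁
  tendsto_limit : Tendsto ψ (𝓝[<] 1) (𝓝 ψ₁)

/-- The pairs `(α j, X j)`, `j = 0, 1, …`, of a real random variable and a process are
independent copies of the pair `(α₀, X₀)`. -/
structure AreIndepCopies {Ω Ω₀ : Type*} [MeasurableSpace Ω] [MeasurableSpace Ω₀]
    (α : ℕ → Ω → ℝ) (X : ℕ → ℕ → Ω → ℕ) (P : Measure Ω)
    (α₀ : Ω₀ → ℝ) (X₀ : ℕ → Ω₀ → ℕ) (P₀ : Measure Ω₀) : Prop where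
  identDistrib : ∀ j, IdentDistrib (fun ω => (α j ω, fun k => X j k ω))
    (fun ω => (α₀ ω, fun k => X₀ k ω)) P P₀
  indep : iIndepFun (fun j ω => (α j ω, fun k => X j k ω)) P

/-- The aggregated partial sum process
`S t = ∑_{j=1}^N ∑_{k=1}^{⌊n t⌋} (X⁽ʲ⁾_k - lam / (1 - α⁽ʲ⁾))`, with the copies numbered from `0`.
Here `lam / (1 - α⁽ʲ⁾)` is the conditional mean of `X⁽ʲ⁾_k` given `α⁽ʲ⁾`. -/
def aggregatedSum {Ω : Type*} (lam : ℝ) (α : ℕ → Ω → ℝ) (X : ℕ → ℕ → Ω → ℕ) (N n : ℕ)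
    (t : ℝ≥0) (ω : Ω) : ℝ :=
  ∑ j ∈ Finset.range N, ∑ k ∈ Finset.Icc 1 ⌊(n : ℝ) * (t : ℝ)⌋₊,
    ((X j k ω : ℝ) - lam / (1 - α j ω))

/-- Weak convergence of the finite-dimensional distributions of real-valued processes indexed by
`[0, ∞)`. -/
def TendstoFDD {Ω Ω' : Type*} [MeasurableSpace Ω] [MeasurableSpace Ω']
    (Y : ℕ → ℝ≥0 → Ω → ℝ) (Z : ℝ≥0 → Ω' → ℝ)
    (P : Measure Ω) [IsProbabilityMeasure P] (P' : Measure Ω') [IsProbabilityMeasure P'] : Prop :=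
  ∀ (m : ℕ) (t : Fin m → ℝ≥0),
    TendstoInDistribution (fun n ω => fun i => Y n (t i) ω) atTop (fun ω => fun i => Z (t i) ω)
      (fun _ => P) P'

end

/-! The limit is a random line because each relevant path barely moves on the time scale n. Write
X_k - λ/(1-α) = (X_0 - λ/(1-α)) + (X_k - X_0). Summed over k ≤ ⌊nt⌋ and over the copies, this gives
⌊nt⌋ times a single sum of centred initial values, plus a remainder (`aggregatedSum_eq`).

The first part is a central limit theorem with infinite variance. Given α, the centred initial value
has variance λ/(1-α), whose mean diverges logarithmically: cut off at 1-α > δ, it is asymptotic to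
λψ₁ log(1/δ). Integrating the conditional Poisson characteristic function turns the unconditional
one into the Laplace-type transform of 1/(1-α) at z = λ(1 + ib - e^{ib}) ≈ λb²/2
(`charFun_centred_init`). That transform is 1 - zψ₁ log(1/|z|)(1 + o(1)) (`exists_laplace_bound`,
`tendsto_truncated_mean`). With b = u(N log N)^{-1/2} one has log(1/|z|) ~ log N, so N times the
deviation from 1 tends to -λψ₁u²/2 (`tendsto_charFun_mul_sub_one`).

The remainder is controlled in mean square. Given α, E(X_k - X_0)² = 2λ(1-α^k)/(1-α)
(`increment_moments`). Splitting at 1-α = 1/n bounds its average by a constant times k/n + log n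
(`exists_increment_bound`). After norming, the variance of the remainder is O(log n / log N_n), and
log N_n eventually exceeds √n. Slutsky's theorem then combines the two parts for all times at once.
-/

/-! ### Moments of the Poisson and Bernoulli inputs, and Fubini for independent pairs. -/

lemma hasSum_poisson_mul (r : ℝ) :
    HasSum (fun n : ℕ => Real.exp (-r) * r ^ n / (n ! : ℝ) * (n : ℝ)) r ∧
    HasSum (fun n : ℕ => Real.exp (-r) * r ^ n / (n ! : ℝ) * ((n : ℝ) ^ 2)) (r ^ 2 + r) := by
  have h0 : HasSum (fun n : ℕ => Real.exp (-r) * r ^ n / (n ! : ℝ)) 1 := by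
    have := (NormedSpace.expSeries_div_hasSum_exp (r : ℝ)).mul_left (Real.exp (-r))
    rw [← Real.exp_eq_exp_ℝ, ← Real.exp_add] at this
    simpa [mul_div_assoc] using this
  have h1 : HasSum (fun n : ℕ => Real.exp (-r) * r ^ n / (n ! : ℝ) * (n : ℝ)) r := by
    rw [← hasSum_nat_add_iff' 1]
    convert! h0.mul_left r using 1
    · funext n
      rw [Nat.factorial_succ]
      push_cast
      field_simp
      ring
    · simp
  refine ⟨h1, ?_⟩
  rw [← hasSum_nat_add_iff' 1]
  convert! (h1.add h0).mul_left r using 1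
  · funext n
    rw [Nat.factorial_succ]
    push_cast
    field_simp
    ring
  · simp; ring

lemma poissonMeasure_moments (r : ℝ≥0) :
    MemLp (fun n : ℕ => (n : ℝ)) 2 (poissonMeasure r) ∧ ∫ n : ℕ, (n : ℝ) ∂poissonMeasure r = r ∧
      ∫ n : ℕ, (n : ℝ) ^ 2 ∂poissonMeasure r = (r : ℝ) ^ 2 + r := by
  obtain ⟨h1, h2⟩ := hasSum_poisson_mul r
  refine ⟨?_, ?_, ?_⟩
  · rw [memLp_two_iff_integrable_sq (by fun_prop), integrable_poissonMeasure_iff]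
    simpa using h2.summable
  · rw [integral_poissonMeasure]
    simpa using h1.tsum_eq
  · rw [integral_poissonMeasure]
    simpa using h2.tsum_eq

/-- Fubini's theorem for a nonnegative function of two independent random variables. -/
lemma ProbabilityTheory.IndepFun.integral_prodMk_of_nonneg {Ω β γ : Type*} [MeasurableSpace Ω]
    [MeasurableSpace β] [MeasurableSpace γ] {Q : Measure Ω} [IsProbabilityMeasure Q]
    {U : Ω → β} {V : Ω → γ} (hU : Measurable U) (hV : Measurable V) (h : IndepFun U V Q)
    {F : β × γ → ℝ} (hF : Measurable F) (hF0 : ∀ p, 0 ≤ F p) {g : β → ℝ}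
    (hFi : ∀ x, Integrable (fun ω => F (x, V ω)) Q) (hFg : ∀ x, ∫ ω, F (x, V ω) ∂Q = g x)
    (hg : Integrable (fun ω => g (U ω)) Q) (hgm : Measurable g) :
    Integrable (fun ω => F (U ω, V ω)) Q ∧ ∫ ω, F (U ω, V ω) ∂Q = ∫ ω, g (U ω) ∂Q := by
  have hmap : Q.map (fun ω => (U ω, V ω)) = (Q.map U).prod (Q.map V) :=
    h.map_prod_eq_prod_map_map hU.aemeasurable hV.aemeasurable
  have : IsProbabilityMeasure (Q.map U) := Measure.isProbabilityMeasure_map hU.aemeasurable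
  have : IsProbabilityMeasure (Q.map V) := Measure.isProbabilityMeasure_map hV.aemeasurable
  have hFx (x : β) : Measurable fun v => F (x, v) := hF.comp measurable_prodMk_left
  have hin (x : β) : ∫ v, F (x, v) ∂(Q.map V) = g x := by
    rw [integral_map hV.aemeasurable (hFx x).aestronglyMeasurable, hFg]
  have hI : Integrable F ((Q.map U).prod (Q.map V)) := by
    rw [integrable_prod_iff (by fun_prop)]
    constructor
    · refine ae_of_all _ fun x => ?_
      rw [integrable_map_measure (hFx x).aestronglyMeasurable hV.aemeasurable]
      exact hFi x
    · have : (fun x => ∫ y, ‖F (x, y)‖ ∂(Q.map V)) = g := by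
        funext x
        rw [← hin x]
        exact integral_congr_ae (ae_of_all _ fun y => by simp [abs_of_nonneg (hF0 _)])
      rw [this, integrable_map_measure (by fun_prop) hU.aemeasurable]
      exact hg
  have hI' := hI
  rw [← hmap, integrable_map_measure (by fun_prop) (by fun_prop)] at hI'
  refine ⟨hI', ?_⟩
  have h1 : ∫ ω, F (U ω, V ω) ∂Q = ∫ p, F p ∂(Q.map (fun ω => (U ω, V ω))) :=
    (integral_map (by fun_prop) (by fun_prop)).symm
  rw [h1, hmap, integral_prod _ hI]
  simp_rw [hin]
  rw [integral_map hU.aemeasurable (by fun_prop)]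

/-! ### The INAR(1) process with a fixed thinning parameter. -/

/-- The inputs of an INAR(1) process with fixed thinning parameter `a`: they are independent, the
thinning variables are Bernoulli with mean `a`, the innovations and the initial value are Poisson
with parameters `r` and `m`. -/
structure IsINARInputs {Ω : Type*} [MeasurableSpace Ω] (r m : ℝ≥0) (a : ℝ)
    (X₀ : Ω → ℕ) (ξ : ℕ → ℕ → Ω → ℕ) (ε : ℕ → Ω → ℕ) (Q : Measure Ω) : Prop where
  measurable_inputs : ∀ i, Measurable (inarInputs X₀ ξ ε i)
  indep : iIndepFun (inarInputs X₀ ξ ε) Q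
  thin_one : ∀ k j, Q.real (ξ k j ⁻¹' {1}) = a
  thin_zero : ∀ k j, Q.real (ξ k j ⁻¹' {0}) = 1 - a
  innov_law : ∀ k, Q.map (ε k) = poissonMeasure r
  init_law : Q.map X₀ = poissonMeasure m

lemma bernoulli_moments {Ω : Type*} [MeasurableSpace Ω] {Q : Measure Ω} [IsProbabilityMeasure Q]
    {Y : Ω → ℕ} {a : ℝ} (hY : Measurable Y) (h1 : Q.real (Y ⁻¹' {1}) = a)
    (h0 : Q.real (Y ⁻¹' {0}) = 1 - a) :
    MemLp (fun ω => (Y ω : ℝ)) 2 Q ∧ ∫ ω, (Y ω : ℝ) ∂Q = a ∧ ∫ ω, (Y ω : ℝ) ^ 2 ∂Q = a := by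
  have hm1 : MeasurableSet (Y ⁻¹' {1}) := hY (measurableSet_singleton _)
  have hm0 : MeasurableSet (Y ⁻¹' {0}) := hY (measurableSet_singleton _)
  have hae : ∀ᵐ ω ∂Q, Y ω = 0 ∨ Y ω = 1 := by
    have hd : Disjoint (Y ⁻¹' {0}) (Y ⁻¹' {1}) :=
      Disjoint.preimage _ (by simp)
    have hu : Q.real (Y ⁻¹' {0} ∪ Y ⁻¹' {1}) = 1 := by
      rw [measureReal_union hd hm1, h0, h1]; ring
    have := (prob_compl_eq_zero_iff (μ := Q) (hm0.union hm1)).2 (by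
      rwa [measureReal_def, ENNReal.toReal_eq_one_iff] at hu)
    filter_upwards [compl_mem_ae_iff.2 this] with ω hω
    simpa [or_iff_not_imp_left] using hω
  have hind : (fun ω => (Y ω : ℝ)) =ᵐ[Q] (Y ⁻¹' {1}).indicator 1 := by
    filter_upwards [hae] with ω hω
    rcases hω with h | h <;> simp [h, Set.indicator]
  have hind2 : (fun ω => (Y ω : ℝ) ^ 2) =ᵐ[Q] (Y ⁻¹' {1}).indicator 1 := by
    filter_upwards [hae] with ω hω
    rcases hω with h | h <;> simp [h, Set.indicator]
  refine ⟨?_, ?_, ?_⟩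
  · rw [memLp_congr_ae hind]
    exact (memLp_const (1 : ℝ)).indicator hm1
  · rw [integral_congr_ae hind, integral_indicator_one hm1, h1]
  · rw [integral_congr_ae hind2, integral_indicator_one hm1, h1]

lemma moments_of_map_eq_poissonMeasure {Ω : Type*} [MeasurableSpace Ω] {Q : Measure Ω}
    {Y : Ω → ℕ} {r : ℝ≥0} (hY : Measurable Y) (h : Q.map Y = poissonMeasure r) :
    MemLp (fun ω => (Y ω : ℝ)) 2 Q ∧ ∫ ω, (Y ω : ℝ) ∂Q = r ∧
      ∫ ω, (Y ω : ℝ) ^ 2 ∂Q = (r : ℝ) ^ 2 + r := by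
  obtain ⟨h1, h2, h3⟩ := poissonMeasure_moments r
  rw [← h] at h1 h2 h3
  rw [integral_map hY.aemeasurable (by fun_prop)] at h2 h3
  exact ⟨h1.comp_of_map hY.aemeasurable, h2, h3⟩

namespace IsINARInputs

variable {Ω : Type*} [MeasurableSpace Ω] {r m : ℝ≥0} {a : ℝ}
    {X₀ : Ω → ℕ} {ξ : ℕ → ℕ → Ω → ℕ} {ε : ℕ → Ω → ℕ} {Q : Measure Ω}

/-- With the previous state frozen at x, one step is a sum of x Bernoulli variables and one Poisson
variable, all independent, so means and variances add. These are the conditional moments fed into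
Fubini in `process_moments`. -/
lemma step_moments [IsProbabilityMeasure Q] (h : IsINARInputs r m a X₀ ξ ε Q) (k x : ℕ) :
    MemLp (fun ω => ((∑ j ∈ Finset.range x, ξ k j ω + ε k ω : ℕ) : ℝ)) 2 Q ∧
    ∫ ω, ((∑ j ∈ Finset.range x, ξ k j ω + ε k ω : ℕ) : ℝ) ∂Q = a * x + r ∧
    ∫ ω, ((∑ j ∈ Finset.range x, ξ k j ω + ε k ω : ℕ) : ℝ) ^ 2 ∂Q
      = (a * x + r) ^ 2 + a * (1 - a) * x + r := by
  classical
  have hξ (j : ℕ) := bernoulli_moments (h.measurable_inputs (.thin k j)) (h.thin_one k j)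
    (h.thin_zero k j)
  have hε := moments_of_map_eq_poissonMeasure (h.measurable_inputs (.innov k)) (h.innov_law k)
  simp only [inarInputs] at hξ hε
  have hvξ (j : ℕ) : variance (fun ω => (ξ k j ω : ℝ)) Q = a * (1 - a) := by
    rw [variance_eq_sub (hξ j).1]
    simp only [Pi.pow_apply, (hξ j).2.1, (hξ j).2.2]; ring
  have hvε : variance (fun ω => (ε k ω : ℝ)) Q = r := by
    rw [variance_eq_sub hε.1]
    simp only [Pi.pow_apply, hε.2.1, hε.2.2]; ring
  set f : INARInput → Ω → ℝ := fun i ω => (inarInputs X₀ ξ ε i ω : ℝ) with hf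
  set e : ℕ ↪ INARInput := ⟨fun j => .thin k j, fun i j hij => by simpa using hij⟩ with he
  set s : Finset INARInput := insert (.innov k) ((Finset.range x).map e) with hs
  have hns : INARInput.innov k ∉ (Finset.range x).map e := by simp [he]
  have hT : (fun ω => ((∑ j ∈ Finset.range x, ξ k j ω + ε k ω : ℕ) : ℝ)) = ∑ i ∈ s, f i := by
    funext ω
    have (j : ℕ) : f (e j) ω = ξ k j ω := rfl
    have h' : f (.innov k) ω = ε k ω := rfl
    simp [hs, Finset.sum_insert hns, this, h', add_comm]
  have hL : ∀ i ∈ s, MemLp (f i) 2 Q := by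
    intro i hi
    simp only [hs, Finset.mem_insert, Finset.mem_map] at hi
    rcases hi with rfl | ⟨j, -, rfl⟩
    · exact hε.1
    · exact (hξ j).1
  have hTL : MemLp (∑ i ∈ s, f i) 2 Q := memLp_finsetSum' _ hL
  have hmean : ∫ ω, (∑ i ∈ s, f i) ω ∂Q = a * x + r := by
    simp only [Finset.sum_apply]
    rw [integral_finsetSum _ fun i hi => (hL i hi).integrable (by norm_num)]
    simp only [hs, Finset.sum_insert hns, Finset.sum_map]
    have (j : ℕ) : ∫ ω, f (e j) ω ∂Q = a := (hξ j).2.1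
    simp only [this]
    rw [show ∫ ω, f (.innov k) ω ∂Q = r from hε.2.1]
    simp; ring
  have hvar : variance (∑ i ∈ s, f i) Q = a * (1 - a) * x + r := by
    rw [IndepFun.variance_sum hL]
    · simp only [hs, Finset.sum_insert hns, Finset.sum_map]
      have (j : ℕ) : variance (f (e j)) Q = a * (1 - a) := hvξ j
      simp only [this]
      rw [show variance (f (.innov k)) Q = r from hvε]
      simp; ring
    · intro i _ j _ hij
      exact (h.indep.indepFun hij).comp
        (measurable_from_nat (f := (Nat.cast : ℕ → ℝ)))
        (measurable_from_nat (f := (Nat.cast : ℕ → ℝ)))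
  rw [variance_eq_sub hTL, hmean] at hvar
  refine ⟨hT ▸ hTL, ?_, ?_⟩
  · rw [← hmean, hT]
  · have : ∫ ω, ((∑ j ∈ Finset.range x, ξ k j ω + ε k ω : ℕ) : ℝ) ^ 2 ∂Q
        = ∫ ω, ((∑ i ∈ s, f i) ^ 2) ω ∂Q := by rw [← hT]; rfl
    rw [this]
    linarith

/-- The inputs used up to time `k`. -/
def past (k : ℕ) : Set INARInput :=
  {i | match i with | .init => True | .thin l _ => l < k | .innov l => l < k}

/-- The inputs used in step `k`. -/
def current (k : ℕ) : Set INARInput :=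
  {i | match i with | .init => False | .thin l _ => l = k | .innov l => l = k}

lemma past_mono {k l : ℕ} (h : k ≤ l) : past k ⊆ past l := by
  intro i hi
  cases i <;> simp_all [past] <;> omega

lemma disjoint_past_current (k : ℕ) : Disjoint (past k) (current k) := by
  rw [Set.disjoint_left]
  intro i hi hi'
  cases i <;> simp_all [past, current]

end IsINARInputs

/-- The number of summands is random but takes countably many values, so it suffices to check each
fixed value. -/
lemma measurable_sum_range_comp {Ω : Type*} {mΩ : MeasurableSpace Ω} {Y : Ω → ℕ} {ξ : ℕ → Ω → ℕ}
    (hY : Measurable Y) (hξ : ∀ j, Measurable (ξ j)) :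
    Measurable (fun ω => ∑ j ∈ Finset.range (Y ω), ξ j ω) := by
  have : Measurable (fun p : ℕ × Ω => ∑ j ∈ Finset.range p.1, ξ j p.2) :=
    measurable_from_prod_countable_right fun x => by
      simpa using Finset.measurable_fun_sum _ fun j _ => hξ j
  exact this.comp (hY.prodMk measurable_id)

/-- Only the inputs used before time k are assumed measurable, and the σ-algebra is arbitrary. The
lemma therefore also applies to the σ-algebra generated by the past, as needed for the Markov-type
independence below. -/
lemma measurable_inarProcess {Ω : Type*} {mΩ : MeasurableSpace Ω} {X₀ : Ω → ℕ}
    {ξ : ℕ → ℕ → Ω → ℕ} {ε : ℕ → Ω → ℕ} (k : ℕ)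
    (h : ∀ i ∈ IsINARInputs.past k, Measurable (inarInputs X₀ ξ ε i)) :
    Measurable (inarProcess X₀ ξ ε k) := by
  induction k with
  | zero => exact h .init (by simp [IsINARInputs.past])
  | succ k ih =>
    exact (measurable_sum_range_comp
      (ih fun i hi => h i (IsINARInputs.past_mono (Nat.le_succ k) hi))
      fun j => h (.thin k j) (by simp [IsINARInputs.past])).add
        (h (.innov k) (by simp [IsINARInputs.past]))

namespace IsINARInputs

variable {Ω : Type*} [MeasurableSpace Ω] {r m : ℝ≥0} {a : ℝ}
    {X₀ : Ω → ℕ} {ξ : ℕ → ℕ → Ω → ℕ} {ε : ℕ → Ω → ℕ} {Q : Measure Ω}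

/-- Disjoint blocks of an independent family generate independent σ-algebras. The initial value is
kept in the pair so that the mixed moment with X_0 can be propagated. -/
lemma indepFun_past_current (h : IsINARInputs r m a X₀ ξ ε Q) (k : ℕ) :
    IndepFun (fun ω => (X₀ ω, inarProcess X₀ ξ ε k ω)) (fun ω => (fun j => ξ k j ω, ε k ω)) Q := by
  have hind := indep_iSup_of_disjoint (fun i => (h.measurable_inputs i).comap_le) h.indep
    (disjoint_past_current k)
  rw [IndepFun_iff_Indep]
  refine indep_of_indep_of_le_left (indep_of_indep_of_le_right hind ?_) ?_
  · rw [← measurable_iff_comap_le]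
    have hm : ∀ i ∈ current k, Measurable[⨆ n ∈ current k,
        MeasurableSpace.comap (inarInputs X₀ ξ ε n) inferInstance] (inarInputs X₀ ξ ε i) := by
      intro i hi
      rw [measurable_iff_comap_le]
      exact le_iSup₂_of_le i hi le_rfl
    exact @Measurable.prodMk _ _ _ _ _ (_) _ _
      (@measurable_pi_lambda _ _ _ (_) _ _ fun j => hm (.thin k j) (by simp [current]))
      (hm (.innov k) (by simp [current]))
  · rw [← measurable_iff_comap_le]
    have hm : ∀ i ∈ past k, Measurable[⨆ n ∈ past k,
        MeasurableSpace.comap (inarInputs X₀ ξ ε n) inferInstance] (inarInputs X₀ ξ ε i) := by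
      intro i hi
      rw [measurable_iff_comap_le]
      exact le_iSup₂_of_le i hi le_rfl
    exact Measurable.prodMk (hm .init (by simp [past])) (measurable_inarProcess k hm)

/-- Full stationarity is not needed: the first two moments are fixed by the recursion because m
solves am + r = m, while each step multiplies the covariance with X_0 by a. -/
lemma process_moments [IsProbabilityMeasure Q] (h : IsINARInputs r m a X₀ ξ ε Q)
    (hm : a * m + r = m) (k : ℕ) :
    MemLp (fun ω => (inarProcess X₀ ξ ε k ω : ℝ)) 2 Q ∧
    ∫ ω, (inarProcess X₀ ξ ε k ω : ℝ) ∂Q = m ∧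
    ∫ ω, (inarProcess X₀ ξ ε k ω : ℝ) ^ 2 ∂Q = (m : ℝ) ^ 2 + m ∧
    ∫ ω, (X₀ ω : ℝ) * (inarProcess X₀ ξ ε k ω : ℝ) ∂Q = (m : ℝ) ^ 2 + a ^ k * m := by
  have h0 := moments_of_map_eq_poissonMeasure (h.measurable_inputs .init) h.init_law
  simp only [inarInputs] at h0
  induction k with
  | zero =>
    refine ⟨h0.1, h0.2.1, h0.2.2, ?_⟩
    simpa [inarProcess, sq] using h0.2.2
  | succ k ih =>
    obtain ⟨i1, i2, i3, i4⟩ := ih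
    have hind := h.indepFun_past_current k
    have hX₀ : Measurable X₀ := h.measurable_inputs .init
    have hXk : Measurable (inarProcess X₀ ξ ε k) :=
      measurable_inarProcess k fun i _ => h.measurable_inputs i
    have hU : Measurable (fun ω => (X₀ ω, inarProcess X₀ ξ ε k ω)) := hX₀.prodMk hXk
    have hV : Measurable (fun ω => (fun j => ξ k j ω, ε k ω)) :=
      Measurable.prodMk (measurable_pi_iff.2 fun j => h.measurable_inputs (.thin k j))
        (h.measurable_inputs (.innov k))
    have hS : Measurable (fun p : (ℕ × ℕ) × ((ℕ → ℕ) × ℕ) =>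
        ((∑ j ∈ Finset.range p.1.2, p.2.1 j + p.2.2 : ℕ) : ℝ)) := by
      have := (measurable_sum_range_comp (Ω := (ℕ × ℕ) × ((ℕ → ℕ) × ℕ)) (Y := fun p => p.1.2)
        (ξ := fun j p => p.2.1 j) (by fun_prop) (by fun_prop)).add
        (show Measurable fun p : (ℕ × ℕ) × ((ℕ → ℕ) × ℕ) => p.2.2 by fun_prop)
      exact measurable_from_nat.comp this
    have j1 : Integrable (fun ω => (inarProcess X₀ ξ ε k ω : ℝ)) Q := i1.integrable (by norm_num)
    have j2 : Integrable (fun ω => (inarProcess X₀ ξ ε k ω : ℝ) ^ 2) Q := i1.integrable_sq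
    have j3 : Integrable (fun ω => (X₀ ω : ℝ)) Q := h0.1.integrable (by norm_num)
    have j4 : Integrable (fun ω => (X₀ ω : ℝ) * (inarProcess X₀ ξ ε k ω : ℝ)) Q :=
      h0.1.integrable_mul i1
    have hst (x : ℕ) := h.step_moments k x
    have A := hind.integral_prodMk_of_nonneg hU hV (F := fun p =>
        ((∑ j ∈ Finset.range p.1.2, p.2.1 j + p.2.2 : ℕ) : ℝ)) hS (fun p => by positivity)
        (g := fun x => a * x.2 + r) (fun x => (hst x.2).1.integrable (by norm_num))
        (fun x => (hst x.2).2.1) ((j1.const_mul a).add (integrable_const _)) (by fun_prop)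
    have B := hind.integral_prodMk_of_nonneg hU hV (F := fun p =>
        ((∑ j ∈ Finset.range p.1.2, p.2.1 j + p.2.2 : ℕ) : ℝ) ^ 2) (hS.pow_const 2)
        (fun p => by positivity)
        (g := fun x => (a * x.2 + r) ^ 2 + a * (1 - a) * x.2 + r)
        (fun x => (hst x.2).1.integrable_sq)
        (fun x => (hst x.2).2.2)
        ((((i1.const_mul a).add (memLp_const (r : ℝ))).integrable_sq.add
          (j1.const_mul (a * (1 - a)))).add (integrable_const _)) (by fun_prop)
    have C := hind.integral_prodMk_of_nonneg hU hV (F := fun p =>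
        (p.1.1 : ℝ) * ((∑ j ∈ Finset.range p.1.2, p.2.1 j + p.2.2 : ℕ) : ℝ))
        ((show Measurable fun p : (ℕ × ℕ) × ((ℕ → ℕ) × ℕ) => (p.1.1 : ℝ) by fun_prop).mul hS)
        (fun p => by positivity)
        (g := fun x => x.1 * (a * x.2 + r))
        (fun x => ((hst x.2).1.integrable (by norm_num)).const_mul (x.1 : ℝ))
        (fun x => by simp only; rw [integral_const_mul, (hst x.2).2.1])
        (by
          refine ((j4.const_mul a).add (j3.mul_const (r : ℝ))).congr (ae_of_all _ fun ω => ?_)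
          simp only [Pi.add_apply]; ring) (by fun_prop)
    simp only at A B C
    refine ⟨?_, ?_, ?_, ?_⟩
    · exact (memLp_two_iff_integrable_sq (measurable_from_nat.comp
        (measurable_inarProcess (k + 1) fun i _ => h.measurable_inputs i)).aestronglyMeasurable).2
        B.1
    · refine A.2.trans ?_
      rw [integral_add (j1.const_mul a) (integrable_const _), integral_const_mul, i2]
      simpa using hm
    · refine B.2.trans ?_
      have : ∀ ω, (a * (inarProcess X₀ ξ ε k ω : ℝ) + r) ^ 2
          + a * (1 - a) * (inarProcess X₀ ξ ε k ω : ℝ) + r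
          = a ^ 2 * (inarProcess X₀ ξ ε k ω : ℝ) ^ 2
            + (2 * a * r + a * (1 - a)) * (inarProcess X₀ ξ ε k ω : ℝ) + (r ^ 2 + r) := by
        intro ω; ring
      simp_rw [this]
      rw [integral_add (by fun_prop) (integrable_const _),
        integral_add (j2.const_mul _) (j1.const_mul _), integral_const_mul, integral_const_mul,
        i2, i3]
      simp only [integral_const, probReal_univ, smul_eq_mul, one_mul]
      -- The new second moment collapses to (am + r)² + (am + r), and its difference from m² + m
      -- factors through am + r - m.
      linear_combination (a * m + r + m + 1) * hm
    · refine C.2.trans ?_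
      have : ∀ ω, (X₀ ω : ℝ) * (a * (inarProcess X₀ ξ ε k ω : ℝ) + r)
          = a * ((X₀ ω : ℝ) * (inarProcess X₀ ξ ε k ω : ℝ)) + r * (X₀ ω : ℝ) := by
        intro ω; ring
      simp_rw [this]
      rw [integral_add (j4.const_mul _) (j3.const_mul _), integral_const_mul, integral_const_mul,
        i4, h0.2.1]
      linear_combination (m : ℝ) * hm

lemma increment_moments [IsProbabilityMeasure Q] (h : IsINARInputs r m a X₀ ξ ε Q)
    (hm : a * m + r = m) (k : ℕ) :
    MemLp (fun ω => (inarProcess X₀ ξ ε k ω : ℝ) - X₀ ω) 2 Q ∧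
    ∫ ω, ((inarProcess X₀ ξ ε k ω : ℝ) - X₀ ω) ∂Q = 0 ∧
    ∫ ω, ((inarProcess X₀ ξ ε k ω : ℝ) - X₀ ω) ^ 2 ∂Q = 2 * m * (1 - a ^ k) := by
  have h0 := moments_of_map_eq_poissonMeasure (h.measurable_inputs .init) h.init_law
  simp only [inarInputs] at h0
  obtain ⟨i1, i2, i3, i4⟩ := h.process_moments hm k
  refine ⟨i1.sub h0.1, ?_, ?_⟩
  · rw [integral_sub (i1.integrable (by norm_num)) (h0.1.integrable (by norm_num)), i2, h0.2.1,
      sub_self]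
  · have : ∀ ω, ((inarProcess X₀ ξ ε k ω : ℝ) - X₀ ω) ^ 2 = (inarProcess X₀ ξ ε k ω : ℝ) ^ 2
        + (X₀ ω : ℝ) ^ 2 - 2 * ((X₀ ω : ℝ) * (inarProcess X₀ ξ ε k ω : ℝ)) := by
      intro ω; ring
    simp_rw [this]
    have j4 : Integrable (fun ω => (X₀ ω : ℝ) * (inarProcess X₀ ξ ε k ω : ℝ)) Q :=
      h0.1.integrable_mul i1
    have j5 : Integrable (fun ω => (inarProcess X₀ ξ ε k ω : ℝ) ^ 2 + (X₀ ω : ℝ) ^ 2) Q :=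
      i1.integrable_sq.add h0.1.integrable_sq
    rw [integral_sub j5 (j4.const_mul 2), integral_add i1.integrable_sq h0.1.integrable_sq,
      integral_const_mul, i3, i4, h0.2.2]
    ring

end IsINARInputs

/-! ### Disintegration of the randomized process over its thinning parameter. -/

instance INARInput.instCountable : Countable INARInput := by
  have : Function.Injective (fun i : INARInput => match i with
    | .init => (Sum.inl (Sum.inl ()) : (Unit ⊕ (ℕ × ℕ)) ⊕ ℕ)
    | .thin k j => Sum.inl (Sum.inr (k, j))
    | .innov k => Sum.inr k) := by
    intro i j h
    cases i <;> cases j <;> simp_all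
  exact this.countable

/-- Independence of countably many discrete random variables from the factorization of the
probabilities of finite intersections of level sets. -/
lemma iIndepFun_of_measureReal_biInter_singleton {Ω ι : Type*} [MeasurableSpace Ω]
    {Q : Measure Ω} [IsProbabilityMeasure Q] {f : ι → Ω → ℕ} (hf : ∀ i, Measurable (f i))
    (h : ∀ (s : Finset ι) (n : ι →₀ ℕ),
      Q.real (⋂ i ∈ s, f i ⁻¹' {n i}) = ∏ i ∈ s, Q.real (f i ⁻¹' {n i})) :
    iIndepFun f Q := by
  classical
  rw [iIndepFun_iff_finset]
  intro s
  have hs (i : s) : Measurable (s.restrict f i) := hf i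
  rw [iIndepFun_iff_map_fun_eq_pi_map fun i => (hs i).aemeasurable]
  have (i : s) : IsProbabilityMeasure (Q.map (s.restrict f i)) :=
    Measure.isProbabilityMeasure_map (hs i).aemeasurable
  refine Measure.ext_of_singleton fun m => ?_
  rw [Measure.pi_singleton, Measure.map_apply (measurable_pi_iff.2 hs) (measurableSet_singleton _)]
  -- Extending the level by zero off s makes it finitely supported. Only countably many such levels
  -- exist when the index set is countable, so exceptional null sets can be merged.
  set n : ι →₀ ℕ := Finsupp.onFinset s (fun i => if hi : i ∈ s then m ⟨i, hi⟩ else 0)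
    (fun i hi => by by_contra h'; simp [h'] at hi) with hn
  have hnm (i : s) : n i = m i := by simp [hn]
  have h1 : (fun ω (i : s) => s.restrict f i ω) ⁻¹' {m} = ⋂ i ∈ s, f i ⁻¹' {n i} := by
    ext ω
    simp only [mem_preimage, mem_singleton_iff, funext_iff, mem_iInter, Finset.restrict]
    exact ⟨fun H i hi => (H ⟨i, hi⟩).trans (hnm ⟨i, hi⟩).symm,
      fun H i => (H i i.2).trans (hnm i)⟩
  have h2 (i : s) : Q.map (s.restrict f i) {m i} = Q (f i ⁻¹' {n i}) := by
    rw [Measure.map_apply (hs i) (measurableSet_singleton _), hnm]; rfl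
  simp_rw [h2]
  rw [h1, Finset.prod_coe_sort s (fun i => Q (f i ⁻¹' {n i})),
    ← ENNReal.toReal_eq_toReal_iff' (by finiteness)
      (ENNReal.prod_ne_top fun i _ => by finiteness), ENNReal.toReal_prod]
  exact h s n

lemma map_eq_poissonMeasure_of_measureReal {Ω : Type*} [MeasurableSpace Ω] {Q : Measure Ω}
    [IsProbabilityMeasure Q] {Y : Ω → ℕ} {r : ℝ≥0} (hY : Measurable Y)
    (h : ∀ l : ℕ, Q.real (Y ⁻¹' {l}) = (r : ℝ) ^ l / (l ! : ℝ) * Real.exp (-r)) :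
    Q.map Y = poissonMeasure r := by
  have : IsProbabilityMeasure (Q.map Y) := Measure.isProbabilityMeasure_map hY.aemeasurable
  refine Measure.ext_of_singleton fun l => ?_
  rw [← ENNReal.toReal_eq_toReal_iff' (by finiteness) (by finiteness), ← measureReal_def,
    ← measureReal_def, poissonMeasure_real_singleton,
    map_measureReal_apply hY (measurableSet_singleton _), h]
  ring

namespace IsRandomizedINAR

variable {Ω : Type*} [MeasurableSpace Ω] {lam : ℝ} {α : Ω → ℝ}
    {X₀ : Ω → ℕ} {ξ : ℕ → ℕ → Ω → ℕ} {ε : ℕ → Ω → ℕ} {P : Measure Ω}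

lemma measurable_inputs (h : IsRandomizedINAR lam α X₀ ξ ε P) (i : INARInput) :
    Measurable (inarInputs X₀ ξ ε i) := by
  cases i
  · exact h.measurable_init
  · exact h.measurable_thin _ _
  · exact h.measurable_innov _

lemma ae_map_param_mem (h : IsRandomizedINAR lam α X₀ ξ ε P) :
    ∀ᵐ a ∂P.map α, a ∈ Ioo (0 : ℝ) 1 :=
  (ae_map_iff h.measurable_param.aemeasurable measurableSet_Ioo).2 h.param_mem

/-- The conditional law of the inputs given the thinning parameter. -/
noncomputable def inputKernel (α : Ω → ℝ) (X₀ : Ω → ℕ) (ξ : ℕ → ℕ → Ω → ℕ) (ε : ℕ → Ω → ℕ)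
    (P : Measure Ω) [IsFiniteMeasure P] : Kernel ℝ (INARInput → ℕ) :=
  condDistrib (fun ω i => inarInputs X₀ ξ ε i ω) α P

instance [IsFiniteMeasure P] : IsMarkovKernel (inputKernel α X₀ ξ ε P) :=
  inferInstanceAs (IsMarkovKernel (condDistrib _ _ _))

lemma ae_inputKernel_eq [IsFiniteMeasure P] (h : IsRandomizedINAR lam α X₀ ξ ε P)
    {s : Set (INARInput → ℕ)} (hs : MeasurableSet s) {f : ℝ → ℝ} (hf : Measurable f)
    (hsf : P⟦(fun ω i => inarInputs X₀ ξ ε i ω) ⁻¹' s | MeasurableSpace.comap α inferInstance⟧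
      =ᵐ[P] fun ω => f (α ω)) :
    ∀ᵐ a ∂P.map α, (inputKernel α X₀ ξ ε P a).real s = f a := by
  exact (ae_map_iff h.measurable_param.aemeasurable
    (measurableSet_eq_fun ((Kernel.measurable_coe _ hs).ennreal_toReal) hf)).2 <|
    (condDistrib_ae_eq_condExp h.measurable_param (measurable_pi_iff.2 h.measurable_inputs) hs).trans hsf

/-- This lets every computation with a fixed parameter be used fibrewise. Each defining property is
a family of almost sure identities between conditional probabilities, and the work is to find one
null set of parameters outside which all of them hold. -/
lemma ae_isINARInputs [IsProbabilityMeasure P] (h : IsRandomizedINAR lam α X₀ ξ ε P)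
    (hlam : 0 < lam) :
    ∀ᵐ a ∂P.map α, IsINARInputs lam.toNNReal (lam / (1 - a)).toNNReal a
      (fun z : INARInput → ℕ => z .init) (fun k j z => z (.thin k j)) (fun k z => z (.innov k))
      (inputKernel α X₀ ξ ε P a) := by
  have hms (i : INARInput) (A : Set ℕ) : MeasurableSet ((fun z : INARInput → ℕ => z i) ⁻¹' A) :=
    measurable_pi_apply i (MeasurableSet.of_discrete)
  have hmem := h.ae_map_param_mem
  have hone : ∀ᵐ a ∂P.map α, ∀ k j, (inputKernel α X₀ ξ ε P a).real
      ((fun z : INARInput → ℕ => z (.thin k j)) ⁻¹' {1}) = a := by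
    simp_rw [ae_all_iff]
    exact fun k j => h.ae_inputKernel_eq (hms _ _) measurable_id (h.thin_one k j)
  have hzero : ∀ᵐ a ∂P.map α, ∀ k j, (inputKernel α X₀ ξ ε P a).real
      ((fun z : INARInput → ℕ => z (.thin k j)) ⁻¹' {0}) = 1 - a := by
    simp_rw [ae_all_iff]
    exact fun k j => h.ae_inputKernel_eq (hms _ _) (f := fun a => 1 - a) (by fun_prop)
      (h.thin_zero k j)
  have hinnov : ∀ᵐ a ∂P.map α, ∀ k l : ℕ, (inputKernel α X₀ ξ ε P a).real
      ((fun z : INARInput → ℕ => z (.innov k)) ⁻¹' {l}) =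
        lam ^ l / (l ! : ℝ) * Real.exp (-lam) := by
    simp_rw [ae_all_iff]
    exact fun k l => h.ae_inputKernel_eq (hms _ _) measurable_const (h.innov_law k l)
  have hinit : ∀ᵐ a ∂P.map α, ∀ l : ℕ, (inputKernel α X₀ ξ ε P a).real
      ((fun z : INARInput → ℕ => z .init) ⁻¹' {l}) =
        lam ^ l / ((l ! : ℝ) * (1 - a) ^ l) * Real.exp (-((1 - a)⁻¹ * lam)) := by
    simp_rw [ae_all_iff]
    exact fun l => h.ae_inputKernel_eq (hms _ _)
      (f := fun a => lam ^ l / ((l ! : ℝ) * (1 - a) ^ l) * Real.exp (-((1 - a)⁻¹ * lam)))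
      (by fun_prop) (h.init_law l)
  -- Quantifying over finite sets and finitely supported levels of a countable index type keeps the
  -- quantifiers countable, so they commute with "almost every".
  have hind : ∀ᵐ a ∂P.map α, ∀ (s : Finset INARInput) (n : INARInput →₀ ℕ),
      (inputKernel α X₀ ξ ε P a).real (⋂ i ∈ s, (fun z : INARInput → ℕ => z i) ⁻¹' {n i}) =
        ∏ i ∈ s, (inputKernel α X₀ ξ ε P a).real ((fun z : INARInput → ℕ => z i) ⁻¹' {n i}) := by
    simp_rw [ae_all_iff]
    intro s n
    refine h.ae_inputKernel_eq (Finset.measurableSet_biInter s fun i _ => hms _ _)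
      (f := fun a => ∏ i ∈ s, (inputKernel α X₀ ξ ε P a).real
        ((fun z : INARInput → ℕ => z i) ⁻¹' {n i}))
      (Finset.measurable_fun_prod _ fun i _ =>
        (Kernel.measurable_coe _ (hms i {n i})).ennreal_toReal) ?_
    have hc := h.condIndep s fun i => {n i}
    have hall : ∀ᵐ ω ∂P, ∀ i ∈ s, (inputKernel α X₀ ξ ε P (α ω)).real
        ((fun z : INARInput → ℕ => z i) ⁻¹' {n i}) =
        (P⟦inarInputs X₀ ξ ε i ⁻¹' {n i} | MeasurableSpace.comap α inferInstance⟧) ω := by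
      rw [Finset.eventually_all]
      exact fun i _ => condDistrib_ae_eq_condExp h.measurable_param
        (measurable_pi_iff.2 h.measurable_inputs) (hms i {n i})
    have hpre : (fun ω i => inarInputs X₀ ξ ε i ω) ⁻¹'
        (⋂ i ∈ s, (fun z : INARInput → ℕ => z i) ⁻¹' {n i}) =
        ⋂ i ∈ s, inarInputs X₀ ξ ε i ⁻¹' {n i} := by
      simp only [preimage_iInter]; rfl
    rw [hpre]
    filter_upwards [hc, hall] with ω h1 h2
    rw [h1]
    exact Finset.prod_congr rfl fun i hi => (h2 i hi).symm
  filter_upwards [hmem, hone, hzero, hinnov, hinit, hind] with a ha h1 h0 hε hX hI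
  have hcoord : inarInputs (fun z : INARInput → ℕ => z .init) (fun k j z => z (.thin k j))
      (fun k z => z (.innov k)) = fun i z => z i := by
    funext i z
    cases i <;> rfl
  have ha1 : 0 < 1 - a := sub_pos.2 ha.2
  refine ⟨?_, ?_, h1, h0, fun k => ?_, ?_⟩
  · rw [hcoord]
    exact fun i => measurable_pi_apply i
  · rw [hcoord]
    exact iIndepFun_of_measureReal_biInter_singleton (fun i => measurable_pi_apply i) hI
  · refine map_eq_poissonMeasure_of_measureReal (measurable_pi_apply _) fun l => ?_
    rw [hε k l, Real.coe_toNNReal _ hlam.le]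
  · refine map_eq_poissonMeasure_of_measureReal (measurable_pi_apply _) fun l => ?_
    rw [hX l, Real.coe_toNNReal _ (div_pos hlam ha1).le, div_pow, div_div, mul_comm (l ! : ℝ),
      div_eq_inv_mul lam]

lemma inarProcess_eq_coordinates {Ω : Type*} {X₀ : Ω → ℕ} {ξ : ℕ → ℕ → Ω → ℕ} {ε : ℕ → Ω → ℕ}
    (k : ℕ) (ω : Ω) :
    inarProcess X₀ ξ ε k ω = inarProcess (fun z : INARInput → ℕ => z .init)
      (fun k j z => z (.thin k j)) (fun k z => z (.innov k)) k
      (fun i => inarInputs X₀ ξ ε i ω) := by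
  induction k with
  | zero => rfl
  | succ k ih => simp only [inarProcess, ih]; rfl

/-- The fibrewise moments are integrated over the parameter. The increment is square integrable
whatever the mixing law, because the factor 1 - a^k cancels the singularity of 1/(1-a). -/
lemma increment_memLp_and_moments [IsProbabilityMeasure P] (h : IsRandomizedINAR lam α X₀ ξ ε P)
    (hlam : 0 < lam) (k : ℕ) :
    MemLp (fun ω => (inarProcess X₀ ξ ε k ω : ℝ) - X₀ ω) 2 P ∧
    ∫ ω, ((inarProcess X₀ ξ ε k ω : ℝ) - X₀ ω) ∂P = 0 ∧
    ∫ ω, ((inarProcess X₀ ξ ε k ω : ℝ) - X₀ ω) ^ 2 ∂P =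
      ∫ a, 2 * (lam / (1 - a)) * (1 - a ^ k) ∂P.map α := by
  have : IsProbabilityMeasure (P.map α) :=
    Measure.isProbabilityMeasure_map h.measurable_param.aemeasurable
  have hΦ : Measurable (fun ω i => inarInputs X₀ ξ ε i ω) :=
    measurable_pi_iff.2 h.measurable_inputs
  set G : (INARInput → ℕ) → ℝ := fun z => (inarProcess (fun z : INARInput → ℕ => z .init)
      (fun k j z => z (.thin k j)) (fun k z => z (.innov k)) k z : ℝ) - z .init with hG
  have hGm : Measurable G := by
    refine (measurable_from_nat.comp (measurable_inarProcess k fun i _ => ?_)).sub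
      (measurable_from_nat.comp (measurable_pi_apply _))
    cases i <;> exact measurable_pi_apply _
  have hG2 : Measurable (fun p : ℝ × (INARInput → ℕ) => G p.2) := hGm.comp measurable_snd
  have hGω : (fun ω => (inarProcess X₀ ξ ε k ω : ℝ) - X₀ ω)
      = fun ω => G (fun i => inarInputs X₀ ξ ε i ω) := by
    funext ω
    rw [inarProcess_eq_coordinates]; rfl
  set κ := inputKernel α X₀ ξ ε P
  have hmap : P.map (fun ω => (α ω, fun i => inarInputs X₀ ξ ε i ω)) = (P.map α) ⊗ₘ κ :=
    (compProd_map_condDistrib hΦ.aemeasurable).symm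
  have hmom : ∀ᵐ a ∂P.map α, MemLp G 2 (κ a) ∧ ∫ z, G z ∂κ a = 0 ∧
      ∫ z, G z ^ 2 ∂κ a = 2 * (lam / (1 - a)) * (1 - a ^ k) := by
    have hmem := h.ae_map_param_mem
    filter_upwards [h.ae_isINARInputs hlam, hmem] with a ha ha'
    have ha1 : 0 < 1 - a := sub_pos.2 ha'.2
    have hm : a * ((lam / (1 - a)).toNNReal : ℝ) + (lam.toNNReal : ℝ)
        = ((lam / (1 - a)).toNNReal : ℝ) := by
      rw [Real.coe_toNNReal _ hlam.le, Real.coe_toNNReal _ (div_pos hlam ha1).le]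
      field_simp; ring
    have := ha.increment_moments hm k
    rwa [Real.coe_toNNReal _ (div_pos hlam ha1).le] at this
  have hpair : Measurable (fun ω => (α ω, fun i => inarInputs X₀ ξ ε i ω)) :=
    h.measurable_param.prodMk hΦ
  have hb : Integrable (fun a => 2 * (lam / (1 - a)) * (1 - a ^ k)) (P.map α) := by
    refine Integrable.of_bound (C := 2 * lam * k) (by fun_prop) ?_
    have hmem := h.ae_map_param_mem
    filter_upwards [hmem] with a ha
    have ha1 : 0 < 1 - a := sub_pos.2 ha.2
    -- Bernoulli's inequality, applied to a = 1 + (a - 1).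
    have hpow : 1 - a ^ k ≤ k * (1 - a) := by
      have := one_add_mul_le_pow (a := a - 1) (by linarith [ha.1]) k
      simp only [add_sub_cancel] at this
      linarith
    have hpow' : 0 ≤ 1 - a ^ k := by
      linarith [pow_le_one₀ (n := k) ha.1.le ha.2.le]
    rw [Real.norm_of_nonneg (by positivity)]
    calc 2 * (lam / (1 - a)) * (1 - a ^ k) ≤ 2 * (lam / (1 - a)) * (k * (1 - a)) := by gcongr
      _ = 2 * lam * k := by field_simp
  have hI2 : Integrable (fun p : ℝ × (INARInput → ℕ) => G p.2 ^ 2) ((P.map α) ⊗ₘ κ) := by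
    rw [Measure.integrable_compProd_iff (hG2.pow_const 2).aestronglyMeasurable]
    constructor
    · filter_upwards [hmom] with a ha using ha.1.integrable_sq
    · refine hb.congr ?_
      filter_upwards [hmom] with a ha
      rw [← ha.2.2]
      simp
  have hL : MemLp (fun p : ℝ × (INARInput → ℕ) => G p.2) 2 ((P.map α) ⊗ₘ κ) :=
    (memLp_two_iff_integrable_sq hG2.aestronglyMeasurable).2 hI2
  refine ⟨?_, ?_, ?_⟩
  · rw [hGω]
    rw [← hmap] at hL
    exact hL.comp_of_map hpair.aemeasurable
  · have : ∫ ω, G (fun i => inarInputs X₀ ξ ε i ω) ∂P = ∫ p, G p.2 ∂((P.map α) ⊗ₘ κ) := by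
      rw [← hmap, integral_map hpair.aemeasurable hG2.aestronglyMeasurable]
    rw [hGω, this, Measure.integral_compProd (hL.integrable (by norm_num))]
    rw [integral_congr_ae (g := fun _ => (0 : ℝ))]
    · simp
    · filter_upwards [hmom] with a ha using ha.2.1
  · have : ∫ ω, G (fun i => inarInputs X₀ ξ ε i ω) ^ 2 ∂P
        = ∫ p, G p.2 ^ 2 ∂((P.map α) ⊗ₘ κ) := by
      rw [← hmap, integral_map hpair.aemeasurable (hG2.pow_const 2).aestronglyMeasurable]
    have e : ∫ ω, ((inarProcess X₀ ξ ε k ω : ℝ) - X₀ ω) ^ 2 ∂P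
        = ∫ ω, G (fun i => inarInputs X₀ ξ ε i ω) ^ 2 ∂P := by
      simp only [funext_iff] at hGω
      simp_rw [hGω]
    rw [e, this, Measure.integral_compProd hI2]
    refine integral_congr_ae ?_
    filter_upwards [hmom] with a ha using ha.2.2

/-- The characteristic function of the centred initial value. -/
lemma charFun_centred_init [IsProbabilityMeasure P] (h : IsRandomizedINAR lam α X₀ ξ ε P)
    (hlam : 0 < lam) (u : ℝ) :
    charFun (P.map fun ω => (X₀ ω : ℝ) - lam / (1 - α ω)) u =
      ∫ a, Complex.exp (-(lam * (1 + u * Complex.I - Complex.exp (u * Complex.I)) /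
        ((1 - a : ℝ) : ℂ))) ∂P.map α := by
  have : IsProbabilityMeasure (P.map α) :=
    Measure.isProbabilityMeasure_map h.measurable_param.aemeasurable
  have hΦ : Measurable (fun ω i => inarInputs X₀ ξ ε i ω) :=
    measurable_pi_iff.2 h.measurable_inputs
  set κ := inputKernel α X₀ ξ ε P
  have hmap : P.map (fun ω => (α ω, fun i => inarInputs X₀ ξ ε i ω)) = (P.map α) ⊗ₘ κ :=
    (compProd_map_condDistrib hΦ.aemeasurable).symm
  have hpair : Measurable (fun ω => (α ω, fun i => inarInputs X₀ ξ ε i ω)) :=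
    h.measurable_param.prodMk hΦ
  have hα := h.measurable_param
  have hX₀ := h.measurable_init
  have hVm : Measurable fun ω => (X₀ ω : ℝ) - lam / (1 - α ω) := by fun_prop
  have hcast : Measurable fun p : ℝ × (INARInput → ℕ) => (p.2 .init : ℝ) := by fun_prop
  set F : ℝ × (INARInput → ℕ) → ℂ := fun p =>
    Complex.exp (u * (((p.2 .init : ℝ) - lam / (1 - p.1) : ℝ) : ℂ) * Complex.I) with hF
  have hFm : Measurable F := by fun_prop
  rw [charFun_apply_real, integral_map hVm.aemeasurable (by fun_prop)]
  have h1 : ∫ ω, Complex.exp (u * (((X₀ ω : ℝ) - lam / (1 - α ω) : ℝ) : ℂ) * Complex.I) ∂P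
      = ∫ p, F p ∂((P.map α) ⊗ₘ κ) := by
    rw [← hmap, integral_map hpair.aemeasurable (by fun_prop)]; rfl
  have hFi : Integrable F ((P.map α) ⊗ₘ κ) := by
    refine Integrable.of_bound (C := 1) (by fun_prop) (ae_of_all _ fun p => ?_)
    simp only [hF]
    rw [← Complex.ofReal_mul, Complex.norm_exp_ofReal_mul_I]
  rw [h1, Measure.integral_compProd hFi]
  refine integral_congr_ae ?_
  have hmem := h.ae_map_param_mem
  filter_upwards [h.ae_isINARInputs hlam, hmem] with a ha ha'
  have ha1 : 0 < 1 - a := sub_pos.2 ha'.2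
  have h2 : ∀ z, F (a, z) = Complex.exp (-(u * (lam / ((1 - a : ℝ) : ℂ)) * Complex.I)) *
      Complex.exp (u * ((z .init : ℕ) : ℝ) * Complex.I) := by
    intro z
    simp only [hF]
    rw [← Complex.exp_add]
    congr 1
    push_cast; ring
  simp_rw [h2]
  rw [integral_const_mul]
  have h3 : ∫ z : INARInput → ℕ, Complex.exp (u * ((z .init : ℕ) : ℝ) * Complex.I) ∂κ a
      = charFun ((poissonMeasure (lam / (1 - a)).toNNReal).map (Nat.cast : ℕ → ℝ)) u := by
    rw [← ha.init_law, charFun_apply_real, integral_map (by fun_prop) (by fun_prop),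
      integral_map (measurable_pi_apply _).aemeasurable (by fun_prop)]
  rw [h3, charFun_map_cast_poissonMeasure, ← Complex.exp_add]
  congr 1
  have : (((lam / (1 - a)).toNNReal : ℝ≥0) : ℂ) = lam / ((1 - a : ℝ) : ℂ) := by
    rw [← Complex.ofReal_div]
    exact congrArg Complex.ofReal (Real.coe_toNNReal _ (div_pos hlam ha1).le)
  rw [this]
  ring

end IsRandomizedINAR

/-! ### Asymptotics of the mixing law near 1. -/

lemma integral_inv_one_sub {x y : ℝ} (hxy : x ≤ y) (hy : y < 1) :
    IntegrableOn (fun a => (1 - a)⁻¹) (Ioo x y) ∧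
      ∫ a in Ioo x y, (1 - a)⁻¹ = Real.log (1 - x) - Real.log (1 - y) := by
  have hc : ContinuousOn (fun a : ℝ => (1 - a)⁻¹) (Icc x y) := by
    refine ContinuousOn.inv₀ (by fun_prop) fun a ha => ?_
    have := ha.2
    exact (by linarith : 0 < 1 - a).ne'
  refine ⟨hc.integrableOn_Icc.mono_set Ioo_subset_Icc_self, ?_⟩
  rw [← integral_Ioc_eq_integral_Ioo, ← intervalIntegral.integral_of_le hxy,
    intervalIntegral.integral_comp_sub_left (fun u => u⁻¹) 1,
    integral_inv_of_pos (by linarith) (by linarith),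
    Real.log_div (by linarith) (by linarith)]

lemma integral_inv_one_sub_sq {x y : ℝ} (hxy : x ≤ y) (hy : y < 1) :
    IntegrableOn (fun a => ((1 - a)⁻¹) ^ 2) (Ioo x y) ∧
      ∫ a in Ioo x y, ((1 - a)⁻¹) ^ 2 = (1 - y)⁻¹ - (1 - x)⁻¹ := by
  have hc : ContinuousOn (fun a : ℝ => ((1 - a)⁻¹) ^ 2) (Icc x y) := by
    refine (ContinuousOn.inv₀ (by fun_prop) fun a ha => ?_).pow 2
    have := ha.2
    exact (by linarith : 0 < 1 - a).ne'
  refine ⟨hc.integrableOn_Icc.mono_set Ioo_subset_Icc_self, ?_⟩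
  rw [← integral_Ioc_eq_integral_Ioo, ← intervalIntegral.integral_of_le hxy]
  refine intervalIntegral.integral_eq_sub_of_hasDerivAt (f := fun a => (1 - a)⁻¹) ?_ ?_
  · intro a ha
    rw [uIcc_of_le hxy] at ha
    have h1 : 1 - a ≠ 0 := (by linarith [ha.2] : 0 < 1 - a).ne'
    have := ((hasDerivAt_id a).const_sub 1).inv h1
    convert! this using 1
    simp
  · exact hc.intervalIntegrable_of_Icc hxy

namespace IsMixingLaw

variable {μ : Measure ℝ} {ψ : ℝ → ℝ} {ψ₁ : ℝ}

lemma ae_mem_Ioo (h : IsMixingLaw μ ψ 0 ψ₁) : ∀ᵐ a ∂μ, a ∈ Ioo (0 : ℝ) 1 := by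
  rw [h.law_eq]
  exact (withDensity_absolutelyContinuous _ _).ae_le (ae_restrict_mem measurableSet_Ioo)

/-- Near `1` the mixing law is comparable with `ψ₁` times Lebesgue measure. -/
lemma exists_restrict_bounds (h : IsMixingLaw μ ψ 0 ψ₁) {η : ℝ} (hη : 0 < η) :
    ∃ δ₀ ∈ Ioo (0 : ℝ) 1, ∀ s ⊆ Ioo (1 - δ₀) 1, MeasurableSet s →
      ENNReal.ofReal (ψ₁ - η) • volume.restrict s ≤ μ.restrict s ∧
      μ.restrict s ≤ ENNReal.ofReal (ψ₁ + η) • volume.restrict s := by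
  have hev : ∀ᶠ x in 𝓝[<] (1 : ℝ), ψ x ∈ Ioo (ψ₁ - η) (ψ₁ + η) :=
    h.tendsto_limit (Ioo_mem_nhds (by linarith) (by linarith))
  obtain ⟨l, hl, hl'⟩ := (mem_nhdsLT_iff_exists_Ioo_subset (a := (1 : ℝ))).1 hev
  have hl1 : l < 1 := hl
  refine ⟨min (1 - l) (1 / 2), ⟨by simp [hl1], by simp; norm_num⟩, fun s hs hsm => ?_⟩
  have hs1 : s ⊆ Ioo 0 1 := fun x hx => ⟨by
    have := (hs hx).1; have := min_le_right (1 - l) (1 / 2); linarith, (hs hx).2⟩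
  have hs2 : ∀ x ∈ s, ψ x ∈ Ioo (ψ₁ - η) (ψ₁ + η) := fun x hx => hl' ⟨by
    have := (hs hx).1; have := min_le_left (1 - l) (1 / 2); linarith, (hs hx).2⟩
  have e : μ.restrict s = (volume.restrict s).withDensity fun x => ENNReal.ofReal (ψ x) := by
    rw [h.law_eq, restrict_withDensity hsm, Measure.restrict_restrict hsm,
      inter_eq_left.2 hs1]
    simp
  rw [e, ← withDensity_const, ← withDensity_const]
  constructor <;> refine withDensity_mono ?_ <;>
    filter_upwards [ae_restrict_mem hsm] with x hx
  · exact ENNReal.ofReal_le_ofReal (hs2 x hx).1.le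
  · exact ENNReal.ofReal_le_ofReal (hs2 x hx).2.le

lemma setIntegral_bounds {η : ℝ} {s : Set ℝ} (hs : MeasurableSet s) (hη : 0 < η) (hη1 : η < ψ₁)
    (hle : ENNReal.ofReal (ψ₁ - η) • volume.restrict s ≤ μ.restrict s ∧
      μ.restrict s ≤ ENNReal.ofReal (ψ₁ + η) • volume.restrict s)
    {f : ℝ → ℝ} (hf : ∀ x ∈ s, 0 ≤ f x) (hfi : IntegrableOn f s) :
    (ψ₁ - η) * ∫ x in s, f x ≤ ∫ x in s, f x ∂μ ∧
      ∫ x in s, f x ∂μ ≤ (ψ₁ + η) * ∫ x in s, f x := by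
  have hI : Integrable f (ENNReal.ofReal (ψ₁ + η) • volume.restrict s) :=
    hfi.smul_measure ENNReal.ofReal_ne_top
  have hIμ : Integrable f (μ.restrict s) := hI.mono_measure hle.2
  have hμ : 0 ≤ᵐ[μ.restrict s] f := by
    filter_upwards [ae_restrict_mem hs] with x hx using hf x hx
  have hv : 0 ≤ᵐ[ENNReal.ofReal (ψ₁ + η) • volume.restrict s] f := by
    refine Measure.ae_smul_measure ?_ _
    filter_upwards [ae_restrict_mem hs] with x hx using hf x hx
  constructor
  · have := integral_mono_measure hle.1 hμ hIμ
    rwa [integral_smul_measure, ENNReal.toReal_ofReal (by linarith), smul_eq_mul] at this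
  · have := integral_mono_measure hle.2 hv hI
    rwa [integral_smul_measure, ENNReal.toReal_ofReal (by linarith), smul_eq_mul] at this

lemma integrableOn_Iic_inv_pow [IsProbabilityMeasure μ] {δ : ℝ}
    (hδ : 0 < δ) (p : ℕ) :
    IntegrableOn (fun a => ((1 - a)⁻¹) ^ p) (Iic (1 - δ)) μ ∧
      0 ≤ ∫ a in Iic (1 - δ), ((1 - a)⁻¹) ^ p ∂μ ∧
      ∫ a in Iic (1 - δ), ((1 - a)⁻¹) ^ p ∂μ ≤ (δ⁻¹) ^ p := by
  have hb : ∀ a ∈ Iic (1 - δ), ‖((1 - a)⁻¹) ^ p‖ ≤ (δ⁻¹) ^ p := by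
    intro a ha
    have ha' : δ ≤ 1 - a := by have := mem_Iic.1 ha; linarith
    have ha0 : 0 < 1 - a := hδ.trans_le ha'
    rw [Real.norm_of_nonneg (by positivity)]
    gcongr
  refine ⟨?_, ?_, ?_⟩
  · refine Integrable.of_bound (C := (δ⁻¹) ^ p) (by fun_prop) ?_
    filter_upwards [ae_restrict_mem measurableSet_Iic] with a ha using hb a ha
  · refine setIntegral_nonneg measurableSet_Iic fun a ha => ?_
    have ha' : δ ≤ 1 - a := by have := mem_Iic.1 ha; linarith
    have ha0 : 0 < 1 - a := hδ.trans_le ha'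
    positivity
  · have := norm_setIntegral_le_of_norm_le_const (μ := μ) (by finiteness) hb
    refine (le_abs_self _).trans (this.trans ?_)
    exact mul_le_of_le_one_right (by positivity) measureReal_le_one

lemma setIntegral_Iio_eq_add [IsProbabilityMeasure μ] {δ δ₀ : ℝ}
    (hδ : 0 < δ) (hδ₀ : δ < δ₀) (p : ℕ) :
    ∫ a in Iio (1 - δ), ((1 - a)⁻¹) ^ p ∂μ =
      ∫ a in Iic (1 - δ₀), ((1 - a)⁻¹) ^ p ∂μ +
        ∫ a in Ioo (1 - δ₀) (1 - δ), ((1 - a)⁻¹) ^ p ∂μ := by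
  rw [← setIntegral_union]
  · rw [Iic_union_Ioo_eq_Iio (by linarith)]
  · rw [Set.disjoint_left]
    exact fun x hx hx' => (not_lt.2 (mem_Iic.1 hx)) hx'.1
  · exact measurableSet_Ioo
  · exact (integrableOn_Iic_inv_pow (μ := μ) (hδ.trans hδ₀) p).1
  · exact (integrableOn_Iic_inv_pow (μ := μ) hδ p).1.mono_set fun x hx => hx.2.le

/-- The truncated mean of `1 / (1 - a)` is asymptotic to `ψ₁ * log (1 / δ)`. -/
lemma tendsto_truncated_mean [IsProbabilityMeasure μ] (h : IsMixingLaw μ ψ 0 ψ₁) :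
    Tendsto (fun δ => (∫ a in Iio (1 - δ), (1 - a)⁻¹ ∂μ) / (-Real.log δ)) (𝓝[>] 0) (𝓝 ψ₁) := by
  rw [Metric.tendsto_nhds]
  intro ρ hρ
  -- One half of ρ pays for the oscillation of the density near 1, the other half for the bounded
  -- terms in `hsmall`. Keeping η below ψ₁ makes the lower density bound positive.
  set η := min (ρ / 2) (ψ₁ / 2) with hη
  have hψ := h.limit_pos
  have hη0 : 0 < η := by positivity
  have hη1 : η < ψ₁ := (min_le_right _ _).trans_lt (by linarith)
  have hηρ : η ≤ ρ / 2 := min_le_left _ _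
  obtain ⟨δ₀, ⟨h0, h1⟩, hb⟩ := h.exists_restrict_bounds hη0
  have hlog : Tendsto (fun δ : ℝ => -Real.log δ) (𝓝[>] 0) atTop :=
    tendsto_neg_atBot_atTop.comp Real.tendsto_log_nhdsGT_zero
  have hsmall : Tendsto (fun δ : ℝ => (δ₀⁻¹ + (ψ₁ + η) * |Real.log δ₀|) / (-Real.log δ)) (𝓝[>] 0)
      (𝓝 0) := tendsto_const_nhds.div_atTop hlog
  filter_upwards [hsmall.eventually_lt_const (half_pos hρ), hlog.eventually_gt_atTop 0,
    Ioo_mem_nhdsGT h0] with δ hδs hδl hδ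
  have hA := setIntegral_Iio_eq_add (μ := μ) hδ.1 hδ.2 1
  obtain ⟨-, hB0, hB1⟩ := integrableOn_Iic_inv_pow (μ := μ) h0 1
  simp only [pow_one] at hA hB0 hB1
  obtain ⟨hi, hv⟩ := integral_inv_one_sub (x := 1 - δ₀) (y := 1 - δ)
    (by linarith [hδ.2]) (by linarith [hδ.1])
  obtain ⟨hl, hu⟩ := setIntegral_bounds measurableSet_Ioo hη0 hη1
    (hb (Ioo (1 - δ₀) (1 - δ)) (Ioo_subset_Ioo_right (by linarith [hδ.1])) measurableSet_Ioo)
    (f := fun a => (1 - a)⁻¹) (fun x hx => by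
      have := hx.2; exact inv_nonneg.2 (by linarith [hδ.1])) hi
  rw [hv] at hl hu
  simp only [sub_sub_cancel] at hl hu
  rw [div_lt_iff₀ hδl] at hδs
  rw [Real.dist_eq, abs_sub_lt_iff, div_sub' hδl.ne', sub_div' hδl.ne', div_lt_iff₀ hδl,
    div_lt_iff₀ hδl, hA]
  have a1 := neg_abs_le (Real.log δ₀)
  have a2 := le_abs_self (Real.log δ₀)
  have b1 : (ψ₁ + η) * Real.log δ₀ ≤ (ψ₁ + η) * |Real.log δ₀| := by gcongr
  have b2 : (ψ₁ - η) * -|Real.log δ₀| ≤ (ψ₁ - η) * Real.log δ₀ :=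
    mul_le_mul_of_nonneg_left a1 (by linarith)
  have b3 : 0 ≤ η * |Real.log δ₀| := by positivity
  have b4 : η * (-Real.log δ) ≤ ρ / 2 * (-Real.log δ) := by gcongr
  have b5 : 0 < δ₀⁻¹ := by positivity
  constructor <;> nlinarith

/-- The mass near `1` and the truncated second moment of `1 / (1 - a)`. -/
lemma exists_tail_bounds [IsProbabilityMeasure μ] (h : IsMixingLaw μ ψ 0 ψ₁) :
    ∃ C, 0 < C ∧ ∀ᶠ δ in 𝓝[>] (0 : ℝ), μ.real (Ici (1 - δ)) ≤ C * δ ∧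
      ∫ a in Iio (1 - δ), ((1 - a)⁻¹) ^ 2 ∂μ ≤ C * δ⁻¹ := by
  have hψ := h.limit_pos
  have hη0 : 0 < ψ₁ / 2 := by positivity
  have hη1 : ψ₁ / 2 < ψ₁ := by linarith
  obtain ⟨δ₀, ⟨h0, h1⟩, hb⟩ := h.exists_restrict_bounds hη0
  -- The first summand pays for the region at distance at least δ₀ from 1 (using 1 ≤ δ⁻¹), the
  -- second is the upper bound for the density closer to 1.
  refine ⟨(δ₀⁻¹) ^ 2 + (ψ₁ + ψ₁ / 2), by positivity, ?_⟩
  filter_upwards [Ioo_mem_nhdsGT h0] with δ hδ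
  constructor
  · have e : μ (Ici (1 - δ)) = μ (Ico (1 - δ) 1) := by
      refine measure_congr ?_
      filter_upwards [h.ae_mem_Ioo] with a ha
      exact propext ⟨fun x => ⟨x, ha.2⟩, fun x => x.1⟩
    have := (hb (Ico (1 - δ) 1) (fun x hx => ⟨by linarith [hx.1, hδ.2], hx.2⟩)
      measurableSet_Ico).2 univ
    simp only [Measure.restrict_apply_univ, Measure.smul_apply, Real.volume_Ico, smul_eq_mul,
      sub_sub_cancel] at this
    rw [measureReal_def, e]
    refine (ENNReal.toReal_mono (by finiteness) this).trans ?_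
    rw [ENNReal.toReal_mul, ENNReal.toReal_ofReal (by positivity), ENNReal.toReal_ofReal hδ.1.le]
    refine mul_le_mul_of_nonneg_right ?_ hδ.1.le
    linarith [sq_nonneg (δ₀⁻¹)]
  · have hA := setIntegral_Iio_eq_add (μ := μ) hδ.1 hδ.2 2
    obtain ⟨-, hB0, hB1⟩ := integrableOn_Iic_inv_pow (μ := μ) h0 2
    obtain ⟨hi, hv⟩ := integral_inv_one_sub_sq (x := 1 - δ₀) (y := 1 - δ)
      (by linarith [hδ.2]) (by linarith [hδ.1])
    obtain ⟨hl, hu⟩ := setIntegral_bounds measurableSet_Ioo hη0 hη1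
      (hb (Ioo (1 - δ₀) (1 - δ)) (Ioo_subset_Ioo_right (by linarith [hδ.1])) measurableSet_Ioo)
      (f := fun a => ((1 - a)⁻¹) ^ 2) (fun x hx => by positivity) hi
    rw [hv] at hu
    simp only [sub_sub_cancel] at hu
    have b1 : 0 < (ψ₁ + ψ₁ / 2) * δ₀⁻¹ := by positivity
    have b2 : 1 ≤ δ⁻¹ := (one_le_inv₀ hδ.1).2 (hδ.2.trans h1).le
    have b3 : 0 ≤ (δ₀⁻¹) ^ 2 := by positivity
    rw [hA]
    nlinarith

/-- Asymptotics of the Laplace transform of `1 / (1 - a)` at `0`. -/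
lemma exists_laplace_bound [IsProbabilityMeasure μ] (h : IsMixingLaw μ ψ 0 ψ₁) :
    ∃ C, ∀ᶠ δ in 𝓝[>] (0 : ℝ), ∀ z : ℂ, ‖z‖ = δ → 0 ≤ z.re →
      ‖∫ a, Complex.exp (-(z / ((1 - a : ℝ) : ℂ))) ∂μ - 1
        + z * ((∫ a in Iio (1 - δ), (1 - a)⁻¹ ∂μ : ℝ) : ℂ)‖ ≤ C * δ := by
  obtain ⟨C, hC, hev⟩ := h.exists_tail_bounds
  -- One C comes from the second-order error of the exponential below 1 - δ, and 2C from the trivial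
  -- bound 2 for the integrand on the remaining mass.
  refine ⟨3 * C, ?_⟩
  filter_upwards [hev, self_mem_nhdsWithin] with δ hδ hδ0 z hz hre
  have hδ0 : 0 < δ := hδ0
  have hmem := h.ae_mem_Ioo
  set E : ℝ → ℂ := fun a => Complex.exp (-(z / ((1 - a : ℝ) : ℂ))) with hE
  have hEm : Measurable E := by fun_prop
  have hE1 : ∀ᵐ a ∂μ, ‖E a‖ ≤ 1 := by
    filter_upwards [hmem] with a ha
    rw [hE, Complex.norm_exp, Complex.neg_re, Complex.div_ofReal_re]
    exact Real.exp_le_one_iff.2 (neg_nonpos.2 (div_nonneg hre (by linarith [ha.2])))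
  have hEi : Integrable E μ := Integrable.of_bound hEm.aestronglyMeasurable 1 hE1
  have hE1i : Integrable (fun a => E a - 1) μ := hEi.sub (integrable_const _)
  have hinv := (integrableOn_Iic_inv_pow (μ := μ) hδ0 1).1.mono_set (Iio_subset_Iic_self)
  have hinv2 := (integrableOn_Iic_inv_pow (μ := μ) hδ0 2).1.mono_set (Iio_subset_Iic_self)
  simp only [pow_one] at hinv
  have e1 : ∫ a, E a ∂μ - 1 = ∫ a in Iio (1 - δ), (E a - 1) ∂μ + ∫ a in Ici (1 - δ), (E a - 1) ∂μ := by
    have := integral_add_compl (μ := μ) (measurableSet_Iio (a := 1 - δ)) hE1i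
    rw [compl_Iio] at this
    rw [this, integral_sub hEi (integrable_const _)]
    simp
  have e2 : z * ((∫ a in Iio (1 - δ), (1 - a)⁻¹ ∂μ : ℝ) : ℂ)
      = ∫ a in Iio (1 - δ), z * (((1 - a)⁻¹ : ℝ) : ℂ) ∂μ := by
    rw [integral_const_mul, integral_complex_ofReal]
  have hzi : IntegrableOn (fun a => z * (((1 - a)⁻¹ : ℝ) : ℂ)) (Iio (1 - δ)) μ :=
    (hinv.ofReal (𝕜 := ℂ)).const_mul z
  rw [e1, e2, add_right_comm, ← integral_add hE1i.integrableOn hzi]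
  have n1 : ‖∫ a in Iio (1 - δ), (E a - 1 + z * (((1 - a)⁻¹ : ℝ) : ℂ)) ∂μ‖
      ≤ ∫ a in Iio (1 - δ), δ ^ 2 * ((1 - a)⁻¹) ^ 2 ∂μ := by
    refine norm_integral_le_of_norm_le (hinv2.const_mul _) ?_
    filter_upwards [ae_restrict_mem measurableSet_Iio] with a ha
    have ha' : δ ≤ 1 - a := by have := mem_Iio.1 ha; linarith
    have ha0 : 0 < 1 - a := hδ0.trans_le ha'
    have hn : ‖-(z / ((1 - a : ℝ) : ℂ))‖ = δ * (1 - a)⁻¹ := by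
      rw [norm_neg, norm_div, hz, Complex.norm_real, Real.norm_of_nonneg ha0.le, div_eq_mul_inv]
    -- Truncating at δ = ‖z‖ is exactly what makes the exponent have norm at most 1 here.
    have := Complex.norm_exp_sub_one_sub_id_le (x := -(z / ((1 - a : ℝ) : ℂ))) (by
      rw [hn, ← div_eq_mul_inv, div_le_one ha0]; exact ha')
    rw [hn, mul_pow] at this
    refine le_trans (le_of_eq ?_) this
    congr 1
    simp only [hE]
    push_cast
    ring
  have n2 : ‖∫ a in Ici (1 - δ), (E a - 1) ∂μ‖ ≤ 2 * μ.real (Ici (1 - δ)) := by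
    refine norm_setIntegral_le_of_norm_le_const_ae (by finiteness) ?_
    filter_upwards [ae_restrict_of_ae hE1] with a ha
    calc ‖E a - 1‖ ≤ ‖E a‖ + ‖(1 : ℂ)‖ := norm_sub_le _ _
      _ ≤ 2 := by rw [norm_one]; linarith
  rw [integral_const_mul] at n1
  refine (norm_add_le _ _).trans ?_
  have n3 : δ ^ 2 * ∫ a in Iio (1 - δ), ((1 - a)⁻¹) ^ 2 ∂μ ≤ C * δ := by
    calc δ ^ 2 * ∫ a in Iio (1 - δ), ((1 - a)⁻¹) ^ 2 ∂μ ≤ δ ^ 2 * (C * δ⁻¹) := by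
          gcongr; exact hδ.2
      _ = C * δ := by field_simp
  linarith [hδ.1]

/-- Mean square of the stationary increments, up to a constant. -/
lemma exists_increment_bound [IsProbabilityMeasure μ] (h : IsMixingLaw μ ψ 0 ψ₁) {lam : ℝ}
    (hlam : 0 < lam) :
    ∃ C, 0 < C ∧ ∀ᶠ n : ℕ in atTop, ∀ k : ℕ,
      ∫ a, 2 * (lam / (1 - a)) * (1 - a ^ k) ∂μ ≤ C * ((k : ℝ) / n + Real.log n) := by
  obtain ⟨C, hC, hev⟩ := h.exists_tail_bounds
  have hψ := h.limit_pos
  have hA := h.tendsto_truncated_mean.eventually_le_const (show ψ₁ < 2 * ψ₁ by linarith)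
  have hinvn : Tendsto (fun n : ℕ => ((n : ℝ))⁻¹) atTop (𝓝[>] 0) :=
    tendsto_inv_atTop_nhdsGT_zero.comp tendsto_natCast_atTop_atTop
  -- The split is at 1 - a = 1/n. Closer to 1, the bound 2λk meets mass at most C/n. Further away, 1
  -- - a^k ≤ 1 leaves the truncated mean, eventually at most 2ψ₁ log n.
  refine ⟨2 * lam * C + 2 * lam * (2 * ψ₁), by positivity, ?_⟩
  filter_upwards [hinvn.eventually hev, hinvn.eventually hA, eventually_gt_atTop 1]
    with n hn1 hn2 hn k
  have hn0 : (0 : ℝ) < n := by positivity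
  set δ : ℝ := (n : ℝ)⁻¹ with hδ
  have hδ0 : 0 < δ := by positivity
  have hlog : 0 < Real.log n := Real.log_pos (by exact_mod_cast hn)
  rw [hδ, Real.log_inv, neg_neg, div_le_iff₀ hlog, ← hδ] at hn2
  have hmem := h.ae_mem_Ioo
  have hpow : ∀ a ∈ Ioo (0 : ℝ) 1, 0 ≤ 2 * (lam / (1 - a)) * (1 - a ^ k) ∧
      2 * (lam / (1 - a)) * (1 - a ^ k) ≤ 2 * lam * k ∧
      2 * (lam / (1 - a)) * (1 - a ^ k) ≤ 2 * lam * (1 - a)⁻¹ := by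
    intro a ha
    have ha1 : 0 < 1 - a := sub_pos.2 ha.2
    have hp : 1 - a ^ k ≤ k * (1 - a) := by
      have := one_add_mul_le_pow (a := a - 1) (by linarith [ha.1]) k
      simp only [add_sub_cancel] at this
      linarith
    have hp' : 0 ≤ 1 - a ^ k := by linarith [pow_le_one₀ (n := k) ha.1.le ha.2.le]
    have hp2 : 1 - a ^ k ≤ 1 := by linarith [pow_nonneg ha.1.le k]
    refine ⟨by positivity, ?_, ?_⟩
    · calc 2 * (lam / (1 - a)) * (1 - a ^ k) ≤ 2 * (lam / (1 - a)) * (k * (1 - a)) := by gcongr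
        _ = 2 * lam * k := by field_simp
    · calc 2 * (lam / (1 - a)) * (1 - a ^ k) ≤ 2 * (lam / (1 - a)) * 1 := by gcongr
        _ = 2 * lam * (1 - a)⁻¹ := by field_simp
  have hi : Integrable (fun a => 2 * (lam / (1 - a)) * (1 - a ^ k)) μ := by
    refine Integrable.of_bound (C := 2 * lam * k) (by fun_prop) ?_
    filter_upwards [hmem] with a ha
    rw [Real.norm_of_nonneg (hpow a ha).1]
    exact (hpow a ha).2.1
  have hinv := (integrableOn_Iic_inv_pow (μ := μ) hδ0 1).1.mono_set (Iio_subset_Iic_self)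
  simp only [pow_one] at hinv
  rw [← integral_add_compl (measurableSet_Iio (a := 1 - δ)) hi, compl_Iio]
  have n1 : ∫ a in Iio (1 - δ), 2 * (lam / (1 - a)) * (1 - a ^ k) ∂μ
      ≤ 2 * lam * (2 * ψ₁ * Real.log n) := by
    calc ∫ a in Iio (1 - δ), 2 * (lam / (1 - a)) * (1 - a ^ k) ∂μ
        ≤ ∫ a in Iio (1 - δ), 2 * lam * (1 - a)⁻¹ ∂μ := by
          refine integral_mono_ae hi.integrableOn (hinv.const_mul _) ?_
          filter_upwards [ae_restrict_of_ae hmem] with a ha using (hpow a ha).2.2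
      _ ≤ _ := by rw [integral_const_mul]; gcongr
  have n2 : ∫ a in Ici (1 - δ), 2 * (lam / (1 - a)) * (1 - a ^ k) ∂μ
      ≤ 2 * lam * k * (C * δ) := by
    have := norm_setIntegral_le_of_norm_le_const_ae (μ := μ) (s := Ici (1 - δ))
      (f := fun a => 2 * (lam / (1 - a)) * (1 - a ^ k)) (C := 2 * lam * k) (by finiteness) (by
        filter_upwards [ae_restrict_of_ae hmem] with a ha
        rw [Real.norm_of_nonneg (hpow a ha).1]
        exact (hpow a ha).2.1)
    refine (le_abs_self _).trans (this.trans ?_)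
    gcongr
    exact hn1.1
  have e : 2 * lam * k * (C * δ) = 2 * lam * C * (k / n) := by rw [hδ]; field_simp
  have p1 : 0 ≤ 2 * lam * C * Real.log n := by positivity
  have p2 : 0 ≤ 2 * lam * (2 * ψ₁) * ((k : ℝ) / n) := by positivity
  rw [e] at n2
  linarith

end IsMixingLaw

/-! ### Norming constants and the limit of the characteristic functions. -/

/-- The norming constants `(N log N)^{-1/2}`. -/
noncomputable def invSqrtMulLog (N : ℕ) : ℝ := ((N : ℝ) * Real.log N) ^ (-(1 / 2) : ℝ)

lemma invSqrtMulLog_sq_mul {N : ℕ} (hN : 2 ≤ N) :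
    invSqrtMulLog N ^ 2 * ((N : ℝ) * Real.log N) = 1 := by
  have h1 : 0 < Real.log N := Real.log_pos (by exact_mod_cast hN)
  have h2 : 0 < (N : ℝ) := by positivity
  have h3 : 0 < (N : ℝ) * Real.log N := by positivity
  rw [invSqrtMulLog, ← Real.rpow_natCast, ← Real.rpow_mul h3.le]
  norm_num
  rw [Real.rpow_neg_one]
  field_simp

lemma tendsto_log_natCast_atTop : Tendsto (fun N : ℕ => Real.log N) atTop atTop :=
  Real.tendsto_log_atTop.comp tendsto_natCast_atTop_atTop

lemma tendsto_invSqrtMulLog : Tendsto invSqrtMulLog atTop (𝓝 0) :=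
  (tendsto_rpow_neg_atTop (by norm_num : (0 : ℝ) < 1 / 2)).comp
    (tendsto_natCast_atTop_atTop.atTop_mul_atTop₀ tendsto_log_natCast_atTop)

/-- Taylor's formula with remainder O(|b|³). It identifies the Laplace argument z as asymptotic to
λb²/2. -/
lemma tendsto_exp_second_order :
    Tendsto (fun b : ℝ => (1 + b * Complex.I - Complex.exp (b * Complex.I)) / (b : ℂ) ^ 2)
      (𝓝[≠] 0) (𝓝 (1 / 2)) := by
  rw [tendsto_iff_norm_sub_tendsto_zero]
  have hlim : Tendsto (fun b : ℝ => |b|) (𝓝[≠] 0) (𝓝 0) := by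
    have : Tendsto (fun b : ℝ => |b|) (𝓝 0) (𝓝 |0|) := continuous_abs.tendsto 0
    rw [abs_zero] at this
    exact this.mono_left nhdsWithin_le_nhds
  refine squeeze_zero' (Eventually.of_forall fun _ => norm_nonneg _) ?_ hlim
  filter_upwards [self_mem_nhdsWithin, hlim.eventually_le_const zero_lt_one] with b hb hb1
  have hb0 : (b : ℂ) ≠ 0 := by exact_mod_cast hb
  have hn : ‖(b : ℂ) * Complex.I‖ = |b| := by simp
  have := Complex.exp_bound (x := b * Complex.I) (by rw [hn]; exact hb1) (n := 3) (by norm_num)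
  rw [hn] at this
  have e : (1 + b * Complex.I - Complex.exp (b * Complex.I)) / (b : ℂ) ^ 2 - 1 / 2
      = -(Complex.exp (b * Complex.I)
        - ∑ m ∈ Finset.range 3, (b * Complex.I) ^ m / (m ! : ℂ)) / (b : ℂ) ^ 2 := by
    have hI : Complex.I ^ 2 = -1 := Complex.I_sq
    simp only [Finset.sum_range_succ, Finset.sum_range_zero, mul_pow, hI]
    simp [Nat.factorial]
    field_simp
    ring
  have hpos : 0 < |b| := abs_pos.2 (by simpa using hb)
  rw [e, norm_div, norm_neg, norm_pow, Complex.norm_real, Real.norm_eq_abs,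
    div_le_iff₀ (by positivity)]
  refine this.trans ?_
  have : ((Nat.succ 3 : ℕ) : ℝ) * ((3 ! : ℕ) * (3 : ℕ) : ℝ)⁻¹ ≤ 1 := by
    norm_num [Nat.factorial]
  calc |b| ^ 3 * (((Nat.succ 3 : ℕ) : ℝ) * ((3 ! : ℕ) * (3 : ℕ) : ℝ)⁻¹) ≤ |b| ^ 3 * 1 := by gcongr
    _ = |b| * |b| ^ 2 := by ring

namespace IsMixingLaw

variable {μ : Measure ℝ} {ψ : ℝ → ℝ} {ψ₁ lam : ℝ}

/-- Let z_N be the Laplace argument and A_N the mean of 1/(1-a) truncated at ‖z_N‖. Then N times the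
deviation from 1 equals -N z_N A_N + O(N‖z_N‖). Here N log N · z_N → λu²/2 and A_N/log N → ψ₁, so
the main term converges while the error is O(1/log N). -/
lemma tendsto_charFun_mul_sub_one [IsProbabilityMeasure μ] (h : IsMixingLaw μ ψ 0 ψ₁)
    (hlam : 0 < lam) {u : ℝ} (hu : u ≠ 0) :
    Tendsto (fun N : ℕ => (N : ℂ) * (∫ a, Complex.exp (-(lam * (1 + (invSqrtMulLog N * u : ℝ) * Complex.I
      - Complex.exp ((invSqrtMulLog N * u : ℝ) * Complex.I)) / ((1 - a : ℝ) : ℂ))) ∂μ - 1))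
      atTop (𝓝 (-(lam * ψ₁ * u ^ 2 / 2 : ℝ))) := by
  set b : ℕ → ℝ := fun N => invSqrtMulLog N * u with hb
  set z : ℕ → ℂ := fun N =>
    lam * (1 + (b N : ℝ) * Complex.I - Complex.exp ((b N : ℝ) * Complex.I)) with hz
  set c : ℝ := lam * u ^ 2 / 2 with hc
  have hc0 : 0 < c := by positivity
  have hlog := tendsto_log_natCast_atTop
  have hb0 : Tendsto b atTop (𝓝[≠] 0) := by
    rw [tendsto_nhdsWithin_iff]
    constructor
    · simpa using tendsto_invSqrtMulLog.mul_const u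
    · filter_upwards [eventually_ge_atTop 2] with N hN
      have := invSqrtMulLog_sq_mul hN
      have h0 : invSqrtMulLog N ≠ 0 := by rintro h0; simp [h0] at this
      exact mul_ne_zero h0 hu
  have hzlim : Tendsto (fun N : ℕ => ((N : ℝ) * Real.log N : ℝ) * z N) atTop (𝓝 (c : ℂ)) := by
    have h1 := (tendsto_exp_second_order.comp hb0).const_mul ((lam * u ^ 2 : ℝ) : ℂ)
    have e : ((lam * u ^ 2 : ℝ) : ℂ) * (1 / 2) = (c : ℂ) := by rw [hc]; push_cast; ring
    rw [e] at h1
    refine h1.congr' ?_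
    filter_upwards [eventually_ge_atTop 2, hb0.eventually self_mem_nhdsWithin] with N hN hbN
    have hbN : (b N : ℂ) ≠ 0 := by exact_mod_cast hbN
    have hs : (b N) ^ 2 * ((N : ℝ) * Real.log N) = u ^ 2 := by
      rw [hb]; simp only; rw [mul_pow]
      linear_combination u ^ 2 * invSqrtMulLog_sq_mul hN
    have hs' : ((u ^ 2 : ℝ) : ℂ) = (b N : ℂ) ^ 2 * (((N : ℝ) * Real.log N : ℝ) : ℂ) := by
      rw [← hs]; push_cast; ring
    simp only [Function.comp_apply]
    rw [Complex.ofReal_mul, hs', hz]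
    field_simp
  have hrlim : Tendsto (fun N : ℕ => ((N : ℝ) * Real.log N) * ‖z N‖) atTop (𝓝 c) := by
    have := hzlim.norm
    rw [Complex.norm_real, Real.norm_of_nonneg hc0.le] at this
    refine this.congr' ?_
    filter_upwards [eventually_ge_atTop 2] with N hN
    have h1 : 0 < Real.log N := Real.log_pos (by exact_mod_cast hN)
    rw [norm_mul, Complex.norm_real, Real.norm_of_nonneg (by positivity)]
  have hNlog : Tendsto (fun N : ℕ => (N : ℝ) * Real.log N) atTop atTop :=
    tendsto_natCast_atTop_atTop.atTop_mul_atTop₀ hlog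
  have hrpos : ∀ᶠ N : ℕ in atTop, 0 < ‖z N‖ := by
    filter_upwards [hrlim.eventually_const_lt hc0, hNlog.eventually_gt_atTop 0] with N h1 h2
    exact pos_of_mul_pos_right h1 h2.le
  have hr0 : Tendsto (fun N => ‖z N‖) atTop (𝓝[>] 0) := by
    rw [tendsto_nhdsWithin_iff]
    refine ⟨?_, hrpos⟩
    refine (hrlim.div_atTop hNlog).congr' ?_
    filter_upwards [hNlog.eventually_gt_atTop 0] with N hN
    rw [mul_div_cancel_left₀ _ hN.ne']
  -- From -log‖z‖ = log N + log log N - log(N log N · ‖z‖), where the last logarithm converges.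
  have hlogr : Tendsto (fun N : ℕ => -Real.log ‖z N‖ / Real.log N) atTop (𝓝 1) := by
    have h1 : Tendsto (fun N : ℕ => Real.log (((N : ℝ) * Real.log N) * ‖z N‖) / Real.log N) atTop
        (𝓝 0) := ((Real.continuousAt_log hc0.ne').tendsto.comp hrlim).div_atTop hlog
    have h2 : Tendsto (fun N : ℕ => Real.log (Real.log N) / Real.log N) atTop (𝓝 0) :=
      (Real.isLittleO_log_id_atTop.tendsto_div_nhds_zero).comp hlog
    have h3 := (h2.const_add 1).sub h1
    simp only [add_zero, sub_zero] at h3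
    refine h3.congr' ?_
    filter_upwards [hrpos, hlog.eventually_gt_atTop 0, eventually_gt_atTop 0] with N hr hl hN
    have hN' : (0 : ℝ) < N := by exact_mod_cast hN
    rw [Real.log_mul (by positivity) hr.ne', Real.log_mul hN'.ne' hl.ne']
    field_simp
    ring
  have hmain : Tendsto (fun N : ℕ => (N : ℂ) * (z N *
      ((∫ a in Iio (1 - ‖z N‖), (1 - a)⁻¹ ∂μ : ℝ) : ℂ))) atTop (𝓝 (c * ψ₁ : ℝ)) := by
    have h1 : Tendsto (fun N : ℕ => (∫ a in Iio (1 - ‖z N‖), (1 - a)⁻¹ ∂μ) / Real.log N) atTop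
        (𝓝 (ψ₁ * 1)) := by
      refine ((h.tendsto_truncated_mean.comp hr0).mul hlogr).congr' ?_
      have hneg : ∀ᶠ N : ℕ in atTop, Real.log ‖z N‖ < 0 :=
        (Real.tendsto_log_nhdsGT_zero.comp hr0).eventually_lt_atBot 0
      filter_upwards [hneg, hlog.eventually_gt_atTop 0] with N hN hl
      simp only [Function.comp_apply]
      have hN' := hN.ne
      generalize (∫ a in Iio (1 - ‖z N‖), (1 - a)⁻¹ ∂μ) = A
      field_simp
    rw [mul_one] at h1
    have h2 := hzlim.mul ((Complex.continuous_ofReal.tendsto ψ₁).comp h1)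
    rw [← Complex.ofReal_mul] at h2
    refine h2.congr' ?_
    filter_upwards [hlog.eventually_gt_atTop 0] with N hl
    have hl' : (Real.log N : ℂ) ≠ 0 := by exact_mod_cast hl.ne'
    simp only [Function.comp_apply]
    generalize (∫ a in Iio (1 - ‖z N‖), (1 - a)⁻¹ ∂μ) = A
    rw [Complex.ofReal_mul, Complex.ofReal_div, Complex.ofReal_natCast]
    field_simp
  obtain ⟨C, hC⟩ := h.exists_laplace_bound
  have hNr : Tendsto (fun N : ℕ => (N : ℝ) * (C * ‖z N‖)) atTop (𝓝 0) := by
    have := (hrlim.div_atTop hlog).const_mul C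
    rw [mul_zero] at this
    refine this.congr' ?_
    filter_upwards [hlog.eventually_gt_atTop 0] with N hl
    field_simp
  have herr : Tendsto (fun N : ℕ => (N : ℂ) * (∫ a, Complex.exp (-(z N / ((1 - a : ℝ) : ℂ))) ∂μ - 1
      + z N * ((∫ a in Iio (1 - ‖z N‖), (1 - a)⁻¹ ∂μ : ℝ) : ℂ))) atTop (𝓝 0) := by
    refine squeeze_zero_norm' ?_ hNr
    filter_upwards [hr0.eventually hC] with N hN
    rw [norm_mul, Complex.norm_natCast]
    gcongr
    refine hN (z N) rfl ?_
    -- The real part of z is λ(1 - cos b), hence nonnegative.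
    rw [hz]
    simp only [Complex.mul_re, Complex.ofReal_re, Complex.ofReal_im, Complex.sub_re,
      Complex.add_re, Complex.one_re, Complex.I_re, Complex.I_im, Complex.exp_ofReal_mul_I_re]
    have := Real.cos_le_one (b N)
    have h1 : 0 ≤ lam * (1 - Real.cos (b N)) := mul_nonneg hlam.le (by linarith)
    simpa using h1
  have := herr.sub hmain
  have e : (0 : ℂ) - ((c * ψ₁ : ℝ) : ℂ) = -((lam * ψ₁ * u ^ 2 / 2 : ℝ) : ℂ) := by
    rw [hc, zero_sub]; push_cast; ring
  rw [e] at this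
  refine this.congr fun N => ?_
  simp only [hz]
  ring

lemma tendsto_charFun_pow [IsProbabilityMeasure μ] (h : IsMixingLaw μ ψ 0 ψ₁)
    (hlam : 0 < lam) (u : ℝ) :
    Tendsto (fun N : ℕ => (∫ a, Complex.exp (-(lam * (1 + (invSqrtMulLog N * u : ℝ) * Complex.I
      - Complex.exp ((invSqrtMulLog N * u : ℝ) * Complex.I)) / ((1 - a : ℝ) : ℂ))) ∂μ) ^ N)
      atTop (𝓝 (Complex.exp (-(lam * ψ₁ * u ^ 2 / 2 : ℝ)))) := by
  rcases eq_or_ne u 0 with rfl | hu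
  · simp
  · refine (Complex.tendsto_one_add_pow_exp_of_tendsto
      (h.tendsto_charFun_mul_sub_one hlam hu)).congr fun N => ?_
    rw [add_sub_cancel]

end IsMixingLaw

/-! ### The central limit theorem for the centred initial values. -/

/-- The centred initial value as a function of the parameter and the path. -/
noncomputable def centredInit (lam : ℝ) (p : ℝ × (ℕ → ℕ)) : ℝ := (p.2 0 : ℝ) - lam / (1 - p.1)

lemma measurable_centredInit (lam : ℝ) : Measurable (centredInit lam) := by
  unfold centredInit; fun_prop

/-- Central limit theorem for the centred initial values, with infinite variance. -/
lemma tendstoInDistribution_centredInit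
    {Ω₀ Ω Ω' : Type*} [MeasurableSpace Ω₀] [MeasurableSpace Ω] [MeasurableSpace Ω']
    {P₀ : Measure Ω₀} [IsProbabilityMeasure P₀] {P : Measure Ω} [IsProbabilityMeasure P]
    {P' : Measure Ω'} [IsProbabilityMeasure P'] {lam ψ₁ : ℝ} (hlam : 0 < lam) {ψ : ℝ → ℝ}
    {α₀ : Ω₀ → ℝ} {X₀ : Ω₀ → ℕ} {ξ : ℕ → ℕ → Ω₀ → ℕ} {ε : ℕ → Ω₀ → ℕ}
    (hmodel : IsRandomizedINAR lam α₀ X₀ ξ ε P₀) (hmix : IsMixingLaw (P₀.map α₀) ψ 0 ψ₁)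
    {α : ℕ → Ω → ℝ} {X : ℕ → ℕ → Ω → ℕ}
    (hcopies : AreIndepCopies α X P α₀ (inarProcess X₀ ξ ε) P₀)
    {W : Ω' → ℝ} (hW : HasLaw W (gaussianReal 0 (lam * ψ₁).toNNReal) P') :
    TendstoInDistribution (fun (N : ℕ) ω => invSqrtMulLog N *
      ∑ j ∈ Finset.range N, centredInit lam (α j ω, fun k => X j k ω)) atTop W (fun _ => P) P' := by
  have : IsProbabilityMeasure (P₀.map α₀) :=
    Measure.isProbabilityMeasure_map hmodel.measurable_param.aemeasurable
  have hid (j : ℕ) := (hcopies.identDistrib j).comp (measurable_centredInit lam)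
  have hind := hcopies.indep.comp (fun _ => centredInit lam) fun _ => measurable_centredInit lam
  simp only [Function.comp_def] at hid hind
  have hm (j : ℕ) := (hid j).aemeasurable_fst
  have hsum (N : ℕ) : AEMeasurable (fun ω => ∑ j ∈ Finset.range N,
      centredInit lam (α j ω, fun k => X j k ω)) P :=
    Finset.aemeasurable_fun_sum _ fun j _ => hm j
  have hψ := hmix.limit_pos
  refine ⟨fun N => (hsum N).const_mul _, hW.aemeasurable, ?_⟩
  -- By Lévy's continuity theorem only characteristic functions matter, and for independent copies
  -- these are N-th powers.
  refine ProbabilityMeasure.tendsto_iff_tendsto_charFun.2 fun t => ?_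
  rw! [hW.map_eq]
  have hlim := hmix.tendsto_charFun_pow hlam t
  have e : charFun (gaussianReal 0 (lam * ψ₁).toNNReal) t
      = Complex.exp (-(lam * ψ₁ * t ^ 2 / 2 : ℝ)) := by
    rw [charFun_gaussianReal]
    congr 1
    have : (((lam * ψ₁).toNNReal : ℝ≥0) : ℂ) = ((lam * ψ₁ : ℝ) : ℂ) :=
      congrArg Complex.ofReal (Real.coe_toNNReal _ (by positivity))
    rw [this]
    push_cast
    ring
  simp only [ProbabilityMeasure.coe_mk]
  rw [e]
  refine hlim.congr fun N => ?_
  rw [charFun_map_mul_comp (hsum N),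
    (hind.restrict _).charFun_map_fun_finsetSum_eq_prod (fun j _ => hm j)]
  simp only [Finset.prod_apply, (hid _).map_eq]
  rw [Finset.prod_const, Finset.card_range, ← hmodel.charFun_centred_init hlam]
  rfl

/-! ### Negligibility of the deviations from the initial values. -/

/-- The sum of the deviations of a path from its initial value. -/
noncomputable def deviationSum (K : ℕ) (p : ℝ × (ℕ → ℕ)) : ℝ :=
  ∑ k ∈ Finset.Icc 1 K, ((p.2 k : ℝ) - p.2 0)

lemma measurable_deviationSum (K : ℕ) : Measurable (deviationSum K) := by
  unfold deviationSum; fun_prop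

/-- Comparing each X_k with X_0 isolates a term that depends on t only through the factor ⌊nt⌋, the
source of the linear limit. -/
lemma aggregatedSum_eq {Ω : Type*} (lam : ℝ) (α : ℕ → Ω → ℝ) (X : ℕ → ℕ → Ω → ℕ) (N n : ℕ)
    (t : ℝ≥0) (ω : Ω) :
    aggregatedSum lam α X N n t ω =
      (⌊(n : ℝ) * (t : ℝ)⌋₊ : ℝ) *
        ∑ j ∈ Finset.range N, centredInit lam (α j ω, fun k => X j k ω) +
      ∑ j ∈ Finset.range N, deviationSum ⌊(n : ℝ) * (t : ℝ)⌋₊ (α j ω, fun k => X j k ω) := by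
  rw [aggregatedSum, Finset.mul_sum, ← Finset.sum_add_distrib]
  refine Finset.sum_congr rfl fun j _ => ?_
  simp only [centredInit, deviationSum, Finset.sum_sub_distrib, Finset.sum_const, Nat.card_Icc,
    add_tsub_cancel_right, nsmul_eq_mul]
  ring

namespace IsRandomizedINAR

variable {Ω : Type*} [MeasurableSpace Ω] {lam : ℝ} {α : Ω → ℝ}
    {X₀ : Ω → ℕ} {ξ : ℕ → ℕ → Ω → ℕ} {ε : ℕ → Ω → ℕ} {P : Measure Ω}

/-- Cauchy–Schwarz over the K summands loses nothing that matters: the factor K² is compensated by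
the n⁻² of the norming. -/
lemma deviationSum_moments [IsProbabilityMeasure P] (h : IsRandomizedINAR lam α X₀ ξ ε P)
    (hlam : 0 < lam) (K : ℕ) {B : ℝ}
    (hB : ∀ k ≤ K, ∫ a, 2 * (lam / (1 - a)) * (1 - a ^ k) ∂P.map α ≤ B) :
    MemLp (fun ω => deviationSum K (α ω, fun k => inarProcess X₀ ξ ε k ω)) 2 P ∧
    ∫ ω, deviationSum K (α ω, fun k => inarProcess X₀ ξ ε k ω) ∂P = 0 ∧
    variance (fun ω => deviationSum K (α ω, fun k => inarProcess X₀ ξ ε k ω)) P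
      ≤ (K : ℝ) ^ 2 * B := by
  have hm (k : ℕ) := h.increment_memLp_and_moments hlam k
  have hL : MemLp (fun ω => deviationSum K (α ω, fun k => inarProcess X₀ ξ ε k ω)) 2 P :=
    memLp_finsetSum _ fun k _ => (hm k).1
  have h0 : ∫ ω, deviationSum K (α ω, fun k => inarProcess X₀ ξ ε k ω) ∂P = 0 := by
    have := integral_finsetSum (μ := P) (Finset.Icc 1 K)
      (f := fun k ω => (inarProcess X₀ ξ ε k ω : ℝ) - X₀ ω)
      fun k _ => (hm k).1.integrable (by norm_num)
    refine this.trans (Finset.sum_eq_zero fun k _ => (hm k).2.1)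
  refine ⟨hL, h0, ?_⟩
  refine (variance_le_expectation_sq hL.aestronglyMeasurable).trans ?_
  have hI : Integrable (fun ω => ∑ k ∈ Finset.Icc 1 K,
      ((inarProcess X₀ ξ ε k ω : ℝ) - X₀ ω) ^ 2) P :=
    integrable_finsetSum _ fun k _ => (hm k).1.integrable_sq
  calc ∫ ω, deviationSum K (α ω, fun k => inarProcess X₀ ξ ε k ω) ^ 2 ∂P
      ≤ ∫ ω, (K : ℝ) * ∑ k ∈ Finset.Icc 1 K, ((inarProcess X₀ ξ ε k ω : ℝ) - X₀ ω) ^ 2 ∂P := by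
        refine integral_mono hL.integrable_sq (hI.const_mul _) fun ω => ?_
        have := sq_sum_le_card_mul_sum_sq (s := Finset.Icc 1 K)
          (f := fun k => (inarProcess X₀ ξ ε k ω : ℝ) - X₀ ω)
        rw [Nat.card_Icc, add_tsub_cancel_right] at this
        exact this
    _ = (K : ℝ) * ∑ k ∈ Finset.Icc 1 K, ∫ ω, ((inarProcess X₀ ξ ε k ω : ℝ) - X₀ ω) ^ 2 ∂P := by
        rw [integral_const_mul, integral_finsetSum _ fun k _ => (hm k).1.integrable_sq]
    _ ≤ (K : ℝ) * ∑ k ∈ Finset.Icc 1 K, B := by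
        gcongr with k hk
        rw [(hm k).2.2]
        exact hB k (Finset.mem_Icc.1 hk).2
    _ = (K : ℝ) ^ 2 * B := by simp; ring

end IsRandomizedINAR

lemma MeasureTheory.tendstoInMeasure_pi {Ω ι : Type*} [MeasurableSpace Ω] [Fintype ι]
    {P : Measure Ω} {f : ℕ → Ω → ι → ℝ}
    (h : ∀ i, TendstoInMeasure P (fun n ω => f n ω i) atTop (fun _ => 0)) :
    TendstoInMeasure P f atTop (fun _ => 0) := by
  rw [tendstoInMeasure_iff_norm]
  intro ρ hρ
  have hs : Tendsto (fun n => ∑ i, P {ω | ρ ≤ ‖f n ω i‖}) atTop (𝓝 0) := by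
    rw [← Finset.sum_const_zero (s := (Finset.univ : Finset ι))]
    refine tendsto_finsetSum _ fun i _ => ?_
    have := tendstoInMeasure_iff_norm.1 (h i) ρ hρ
    simpa using this
  refine tendsto_of_tendsto_of_tendsto_of_le_of_le tendsto_const_nhds hs (fun _ => zero_le)
    fun n => ?_
  refine le_trans (measure_mono ?_) (measure_iUnion_fintype_le P _)
  intro ω hω
  simp only [sub_zero, mem_ofPred_eq, mem_iUnion] at hω ⊢
  by_contra! hc
  exact absurd ((pi_norm_lt_iff hρ).2 hc) (not_lt.2 hω)

/-- Chebyshev's inequality. -/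
lemma MeasureTheory.tendstoInMeasure_of_variance {Ω : Type*} [MeasurableSpace Ω]
    {P : Measure Ω} [IsFiniteMeasure P] {f : ℕ → Ω → ℝ}
    (hf : ∀ n, MemLp (f n) 2 P) (h0 : ∀ n, ∫ ω, f n ω ∂P = 0)
    (hv : Tendsto (fun n => variance (f n) P) atTop (𝓝 0)) :
    TendstoInMeasure P f atTop (fun _ => 0) := by
  rw [tendstoInMeasure_iff_norm]
  intro ρ hρ
  have hs : Tendsto (fun n => ENNReal.ofReal (variance (f n) P / ρ ^ 2)) atTop (𝓝 0) := by
    have := ENNReal.tendsto_ofReal (hv.div_const (ρ ^ 2))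
    simpa using this
  refine tendsto_of_tendsto_of_tendsto_of_le_of_le tendsto_const_nhds hs (fun _ => zero_le)
    fun n => ?_
  have := meas_ge_le_variance_div_sq (hf n) hρ
  rw [h0 n] at this
  exact this

/-- This weak form of the growth condition is enough for the remainder, since log n is negligible
against √n. -/
lemma sqrt_le_log_of_tendsto {N : ℕ → ℕ}
    (hN : Tendsto (fun n : ℕ => Real.log (N n) ^ 2 * (n : ℝ)⁻¹) atTop atTop) :
    ∀ᶠ n : ℕ in atTop, √(n : ℝ) ≤ Real.log (N n) := by
  filter_upwards [hN.eventually_ge_atTop 1, eventually_gt_atTop 0] with n h1 hn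
  have hn' : (0 : ℝ) < n := by exact_mod_cast hn
  rw [← div_eq_mul_inv, le_div_iff₀ hn', one_mul] at h1
  exact Real.sqrt_le_iff.2 ⟨Real.log_natCast_nonneg _, h1⟩

lemma tendsto_atTop_of_log_sq {N : ℕ → ℕ}
    (hN : Tendsto (fun n : ℕ => Real.log (N n) ^ 2 * (n : ℝ)⁻¹) atTop atTop) :
    Tendsto N atTop atTop := by
  rw [← tendsto_natCast_atTop_iff (R := ℝ)]
  refine tendsto_atTop_mono' (f₁ := fun n : ℕ => √(n : ℝ)) _ ?_
    (Real.tendsto_sqrt_atTop.comp (tendsto_natCast_atTop_atTop (R := ℝ)))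
  filter_upwards [sqrt_le_log_of_tendsto hN] with n hn
  exact hn.trans (Real.log_le_self (Nat.cast_nonneg _))

/-- The aggregated deviations from the initial values are negligible. -/
lemma tendstoInMeasure_deviationSum
    {Ω₀ Ω : Type*} [MeasurableSpace Ω₀] [MeasurableSpace Ω]
    {P₀ : Measure Ω₀} [IsProbabilityMeasure P₀] {P : Measure Ω} [IsProbabilityMeasure P]
    {lam ψ₁ : ℝ} (hlam : 0 < lam) {ψ : ℝ → ℝ}
    {α₀ : Ω₀ → ℝ} {X₀ : Ω₀ → ℕ} {ξ : ℕ → ℕ → Ω₀ → ℕ} {ε : ℕ → Ω₀ → ℕ}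
    (hmodel : IsRandomizedINAR lam α₀ X₀ ξ ε P₀) (hmix : IsMixingLaw (P₀.map α₀) ψ 0 ψ₁)
    {α : ℕ → Ω → ℝ} {X : ℕ → ℕ → Ω → ℕ}
    (hcopies : AreIndepCopies α X P α₀ (inarProcess X₀ ξ ε) P₀)
    {N : ℕ → ℕ} (hN : Tendsto (fun n : ℕ => Real.log (N n) ^ 2 * (n : ℝ)⁻¹) atTop atTop)
    (t : ℝ≥0) :
    TendstoInMeasure P (fun (n : ℕ) ω => (n : ℝ)⁻¹ * invSqrtMulLog (N n) *
      ∑ j ∈ Finset.range (N n),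
        deviationSum ⌊(n : ℝ) * (t : ℝ)⌋₊ (α j ω, fun k => X j k ω)) atTop (fun _ => 0) := by
  have : IsProbabilityMeasure (P₀.map α₀) :=
    Measure.isProbabilityMeasure_map hmodel.measurable_param.aemeasurable
  set K : ℕ → ℕ := fun n => ⌊(n : ℝ) * (t : ℝ)⌋₊ with hK
  have hid (n j : ℕ) := (hcopies.identDistrib j).comp (measurable_deviationSum (K n))
  have hind (n : ℕ) := hcopies.indep.comp (fun _ => deviationSum (K n))
    fun _ => measurable_deviationSum (K n)
  simp only [Function.comp_def] at hid hind
  -- A crude bound for every n, needed only for integrability and centring; the quantitative bound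
  -- holds just eventually.
  have hmom (n : ℕ) : ∃ B, ∀ k ≤ K n, ∫ a, 2 * (lam / (1 - a)) * (1 - a ^ k) ∂P₀.map α₀ ≤ B := by
    obtain ⟨B, hB⟩ := ((Finset.range (K n + 1)).image
      fun k => ∫ a, 2 * (lam / (1 - a)) * (1 - a ^ k) ∂P₀.map α₀).bddAbove
    exact ⟨B, fun k hk => hB (by simpa using ⟨k, hk, rfl⟩)⟩
  have hL (n j : ℕ) : MemLp (fun ω => deviationSum (K n) (α j ω, fun k => X j k ω)) 2 P := by
    obtain ⟨B, hB⟩ := hmom n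
    exact (hid n j).memLp_iff.2 (hmodel.deviationSum_moments hlam (K n) hB).1
  have h0 (n j : ℕ) : ∫ ω, deviationSum (K n) (α j ω, fun k => X j k ω) ∂P = 0 := by
    obtain ⟨B, hB⟩ := hmom n
    exact (hid n j).integral_eq.trans (hmodel.deviationSum_moments hlam (K n) hB).2.1
  refine tendstoInMeasure_of_variance
    (fun n => (memLp_finsetSum _ fun j _ => hL n j).const_mul _) (fun n => ?_) ?_
  · rw [integral_const_mul, integral_finsetSum _ fun j _ => (hL n j).integrable (by norm_num)]
    simp [h0]
  obtain ⟨C, hC, hev⟩ := hmix.exists_increment_bound hlam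
  have hbound : Tendsto (fun n : ℕ => (t : ℝ) ^ 2 * (C * ((t : ℝ) + Real.log n)) / √(n : ℝ)) atTop
      (𝓝 0) := by
    have hsq : Tendsto (fun n : ℕ => √(n : ℝ)) atTop atTop :=
      Real.tendsto_sqrt_atTop.comp tendsto_natCast_atTop_atTop
    have h1 : Tendsto (fun n : ℕ => (t : ℝ) / √(n : ℝ)) atTop (𝓝 0) :=
      tendsto_const_nhds.div_atTop hsq
    have h2 : Tendsto (fun n : ℕ => Real.log n / √(n : ℝ)) atTop (𝓝 0) := by
      have := ((isLittleO_log_rpow_atTop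
        (by norm_num : (0 : ℝ) < 1 / 2)).tendsto_div_nhds_zero).comp
        (tendsto_natCast_atTop_atTop (R := ℝ))
      simpa only [Function.comp_def, ← Real.sqrt_eq_rpow] using this
    have := (h1.add h2).const_mul ((t : ℝ) ^ 2 * C)
    rw [add_zero, mul_zero] at this
    refine this.congr fun n => ?_
    ring
  refine squeeze_zero' (Eventually.of_forall fun n => variance_nonneg _ _) ?_ hbound
  filter_upwards [hev, sqrt_le_log_of_tendsto hN, (tendsto_atTop_of_log_sq hN).eventually_ge_atTop 2,
    eventually_gt_atTop 0] with n hn hsq hN2 hn0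
  have hn0' : (0 : ℝ) < n := by exact_mod_cast hn0
  have hKn : (K n : ℝ) / n ≤ t := by
    rw [div_le_iff₀ hn0', mul_comm]
    exact Nat.floor_le (by positivity)
  have hlogn : 0 ≤ Real.log n := Real.log_natCast_nonneg n
  have hB : ∀ k ≤ K n, ∫ a, 2 * (lam / (1 - a)) * (1 - a ^ k) ∂P₀.map α₀
      ≤ C * ((t : ℝ) + Real.log n) := by
    intro k hk
    refine (hn k).trans ?_
    have : (k : ℝ) / n ≤ t := le_trans (by gcongr) hKn
    gcongr
  have hvar : variance (fun ω => ∑ j ∈ Finset.range (N n),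
      deviationSum (K n) (α j ω, fun k => X j k ω)) P
      ≤ (N n : ℝ) * ((K n : ℝ) ^ 2 * (C * ((t : ℝ) + Real.log n))) := by
    have e := IndepFun.variance_sum (s := Finset.range (N n)) (fun j _ => hL n j)
      fun i _ j _ hij => (hind n).indepFun hij
    have e' : (fun ω => ∑ j ∈ Finset.range (N n),
        deviationSum (K n) (α j ω, fun k => X j k ω)) = ∑ j ∈ Finset.range (N n),
          fun ω => deviationSum (K n) (α j ω, fun k => X j k ω) := by
      funext ω; simp
    rw [e', e]
    refine (Finset.sum_le_card_nsmul _ _ ((K n : ℝ) ^ 2 * (C * ((t : ℝ) + Real.log n)))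
      fun j _ => ?_).trans_eq (by simp)
    rw [(hid n j).variance_eq]
    exact (hmodel.deviationSum_moments hlam (K n) hB).2.2
  have hlogN : 0 < Real.log (N n) := Real.log_pos (by exact_mod_cast hN2)
  have hNn : (0 : ℝ) < N n := by positivity
  -- Independence makes the variance grow only like N, so the norming leaves a spare factor 1/log N.
  have hs : invSqrtMulLog (N n) ^ 2 * N n = (Real.log (N n))⁻¹ := by
    have := invSqrtMulLog_sq_mul hN2
    field_simp
    linarith
  have hsqrt : 0 < √(n : ℝ) := Real.sqrt_pos.2 hn0'
  rw [variance_const_mul]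
  calc ((n : ℝ)⁻¹ * invSqrtMulLog (N n)) ^ 2 * variance (fun ω => ∑ j ∈ Finset.range (N n),
        deviationSum (K n) (α j ω, fun k => X j k ω)) P
      ≤ ((n : ℝ)⁻¹ * invSqrtMulLog (N n)) ^ 2 *
        ((N n : ℝ) * ((K n : ℝ) ^ 2 * (C * ((t : ℝ) + Real.log n)))) := by gcongr
    _ = ((K n : ℝ) / n) ^ 2 * (C * ((t : ℝ) + Real.log n)) *
        (invSqrtMulLog (N n) ^ 2 * N n) := by ring
    _ = ((K n : ℝ) / n) ^ 2 * (C * ((t : ℝ) + Real.log n)) / Real.log (N n) := by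
        rw [hs]; exact (div_eq_mul_inv _ _).symm
    _ ≤ (t : ℝ) ^ 2 * (C * ((t : ℝ) + Real.log n)) / √(n : ℝ) := by gcongr

/-! ### Assembly of the finite-dimensional limits. -/

theorem theorem2
    {Ω₀ Ω Ω' : Type*} [MeasurableSpace Ω₀] [MeasurableSpace Ω] [MeasurableSpace Ω']
    (P₀ : Measure Ω₀) [IsProbabilityMeasure P₀]
    (P : Measure Ω) [IsProbabilityMeasure P]
    (P' : Measure Ω') [IsProbabilityMeasure P']
    (lam ψ₁ : ℝ) (hlam : 0 < lam) (ψ : ℝ → ℝ)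
    -- the randomized INAR(1) process and its mixing distribution, with exponent `β = 0`
    (α₀ : Ω₀ → ℝ) (X₀ : Ω₀ → ℕ) (ξ : ℕ → ℕ → Ω₀ → ℕ) (ε : ℕ → Ω₀ → ℕ)
    (hmodel : IsRandomizedINAR lam α₀ X₀ ξ ε P₀)
    (hmix : IsMixingLaw (P₀.map α₀) ψ 0 ψ₁)
    -- its independent copies
    (α : ℕ → Ω → ℝ) (X : ℕ → ℕ → Ω → ℕ)
    (hcopies : AreIndepCopies α X P α₀ (inarProcess X₀ ξ ε) P₀)
    -- the numbers of copies
    (N : ℕ → ℕ) (hNpos : ∀ n, 1 ≤ n → 1 ≤ N n)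
    (hN : Tendsto (fun n : ℕ => Real.log (N n) ^ 2 * (n : ℝ)⁻¹) atTop atTop)
    -- the random slope of the limit
    (W : Ω' → ℝ) (hW : HasLaw W (gaussianReal 0 (lam * ψ₁).toNNReal) P') :
    TendstoFDD
      (fun n t ω => (n : ℝ)⁻¹ * ((N n : ℝ) * Real.log (N n)) ^ (-(1 / 2) : ℝ) *
        aggregatedSum lam α X (N n) n t ω)
      (fun t ω => W ω * (t : ℝ)) P P' := by
  intro m t
  set Z : ℕ → Ω → ℝ := fun n ω => invSqrtMulLog (N n) *
    ∑ j ∈ Finset.range (N n), centredInit lam (α j ω, fun k => X j k ω) with hZdef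
  have hclt := tendstoInDistribution_centredInit hlam hmodel hmix hcopies hW
  have hZ : TendstoInDistribution Z atTop W (fun _ => P) P' :=
    ⟨fun n => hclt.forall_aemeasurable (N n), hclt.aemeasurable_limit,
      hclt.tendsto.comp (tendsto_atTop_of_log_sq hN)⟩
  set c : ℕ → Fin m → ℝ := fun n i => (⌊(n : ℝ) * (t i : ℝ)⌋₊ : ℝ) / n with hc
  have hclim : Tendsto c atTop (𝓝 fun i => (t i : ℝ)) := by
    refine tendsto_pi_nhds.2 fun i => ?_
    have := (tendsto_nat_floor_mul_div_atTop (R := ℝ) (a := (t i : ℝ)) (t i).2).comp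
      tendsto_natCast_atTop_atTop
    refine this.congr fun n => ?_
    simp only [Function.comp_apply, hc, mul_comm]
  have hcm : TendstoInMeasure P (fun n (_ : Ω) => c n) atTop (fun _ i => (t i : ℝ)) :=
    tendstoInMeasure_of_tendsto_ae (fun n => aestronglyMeasurable_const)
      (ae_of_all _ fun _ => hclim)
  -- Slutsky's theorem: all coordinates share the same scalar variable, so joint convergence needs
  -- no multivariate limit theorem.
  have hscaled : TendstoInDistribution (fun n ω i => Z n ω * c n i) atTop
      (fun ω i => W ω * (t i : ℝ)) (fun _ => P) P' :=
    hZ.continuous_comp_prodMk_of_tendstoInMeasure_const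
      (g := fun p : ℝ × (Fin m → ℝ) => fun i => p.1 * p.2 i) (by fun_prop) hcm
      fun n => aemeasurable_const
  set R : ℕ → Ω → Fin m → ℝ := fun n ω i => (n : ℝ)⁻¹ * invSqrtMulLog (N n) *
      ∑ j ∈ Finset.range (N n),
        deviationSum ⌊(n : ℝ) * (t i : ℝ)⌋₊ (α j ω, fun k => X j k ω) with hR
  have hRlim : TendstoInMeasure P R atTop (fun _ => 0) :=
    tendstoInMeasure_pi fun i => tendstoInMeasure_deviationSum hlam hmodel hmix hcopies hN (t i)
  have hRm (n : ℕ) : AEMeasurable (R n) P := by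
    refine aemeasurable_pi_lambda _ fun i => AEMeasurable.const_mul ?_ _
    exact Finset.aemeasurable_fun_sum _ fun j _ =>
      (measurable_deviationSum _).comp_aemeasurable (hcopies.identDistrib j).aemeasurable_fst
  have hfinal := hscaled.add_of_tendstoInMeasure_const hRlim hRm
  refine TendstoInDistribution.congr (fun n => ae_of_all _ fun ω => ?_)
    (ae_of_all _ fun ω => ?_) hfinal
  · funext i
    simp only [Pi.add_apply, hR, hc, hZdef, aggregatedSum_eq]
    rw [invSqrtMulLog]
    ring
  · simp
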